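/- Let $n\ge 1$, $p_1>r>1$, $p_2>s>1$ with $\frac1r+\frac1s=1$, and let $\frac1p=\frac1{p_1}+\frac1{p_2}$ with $p>1$; put $p'=\frac{p}{p-1}$. For measurable $f,g:\mathbb R^n\to\mathbb C$ define the bilinear maximal function $$\mathsf{BM}(f,g)(x)=\sup_{t>0}\frac1{(2t)^n}\int_{[-t,t]^n}|f(x-y)\,g(x+y)|\,dy .$$ A Young function is a continuous, convex, strictly increasing $\Phi:[0,\infty)\to[0,\infty)$ with $\Phi(0)=0$ and $\Phi(t)/t\to\infty$ as $t\to\infty$; its associate function is $\bar\Phi(t)=\sup_{\sigma\ge0}(\sigma t-\Phi(\sigma))$. For a cube $Q$ (sides parallel to the axes) put $$\|h\|_{\Phi,Q}=\inf\Big\{\lambda>0:\ \frac1{|Q|}\int_Q\Phi\big(|h(x)|/\lambda\big)\,dx\le1\Big\}\in[0,\infty],$$ and for $q>1$ write $\Phi\in B_q$ if $\int_c^\infty \Phi(t)\,t^{-q-1}\,dt<\infty$ for some $c>0$. Let $u\ge0$ and $v_1,v_2>0$ (almost everywhere) be finite-valued measurable functions on $\mathbb R^n$, and let $\psi,\phi_1,\phi_2$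 be Young functions with $\bar\psi\in B_{p'}$, $\bar\phi_1\in B_{p_1/r}$, $\bar\phi_2\in B_{p_2/s}$, such that $$\sup_Q\ \big\|u^{1/p}\big\|_{\psi,Q}\,\big\|v_1^{-r/p_1}\big\|_{\phi_1,Q}^{1/r}\,\big\|v_2^{-s/p_2}\big\|_{\phi_2,Q}^{1/s}<\infty,$$ where the supremum is over all cubes $Q$ in $\mathbb R^n$ and $0\cdot\infty=0$. Then there is a constant $C<\infty$ such that for all $f\in L^{p_1}(v_1)$ and $g\in L^{p_2}(v_2)$ the function $\mathsf{BM}(f,g)$ is measurable and $$\|\mathsf{BM}(f,g)\|_{L^p(u)}\le C\,\|f\|_{L^{p_1}(v_1)}\,\|g\|_{L^{p_2}(v_2)},\qquad \|h\|_{L^q(w)}=\Big(\int_{\mathbb R^n}|h|^q\,w\,dx\Big)^{1/q}.$$ -/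

import Mathlib

open MeasureTheory Filter Set
open scoped ENNReal NNReal

noncomputable section

namespace BilinearMaximal

/-- Young functions on `[0, ∞)`; the values at negative arguments play no role. -/
structure IsYoung (Φ : ℝ → ℝ) : Prop where
  continuousOn : ContinuousOn Φ (Ici 0)
  convexOn : ConvexOn ℝ (Ici 0) Φ
  strictMonoOn : StrictMonoOn Φ (Ici 0)
  map_zero : Φ 0 = 0
  tendsto_div : Tendsto (fun t => Φ t / t) atTop atTop

/-- The associate (complementary) function `t ↦ sup_{s ≥ 0} (s t - Φ s)`. For a Young function
the supremum is over a bounded set, see `IsYoung.bddAbove`. -/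
def associate (Φ : ℝ → ℝ) (t : ℝ) : ℝ :=
  sSup ((fun s => s * t - Φ s) '' Ici 0)

theorem IsYoung.nonneg {Φ : ℝ → ℝ} (h : IsYoung Φ) {s : ℝ} (hs : 0 ≤ s) : 0 ≤ Φ s := by
  rw [← h.map_zero]
  exact h.strictMonoOn.monotoneOn (mem_Ici.2 le_rfl) (mem_Ici.2 hs) hs

theorem IsYoung.bddAbove {Φ : ℝ → ℝ} (h : IsYoung Φ) (t : ℝ) :
    BddAbove ((fun s => s * t - Φ s) '' Ici 0) := by
  obtain ⟨A, hA⟩ := eventually_atTop.1 (h.tendsto_div.eventually_ge_atTop t)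
  refine ⟨max A 0 * |t|, ?_⟩
  rintro _ ⟨s, hs, rfl⟩
  have hs : (0 : ℝ) ≤ s := hs
  have h0 := h.nonneg hs
  have hM : (0 : ℝ) ≤ max A 0 * |t| := by positivity
  rcases le_or_gt s (max A 0) with h1 | h1
  · have : s * t ≤ max A 0 * |t| :=
      (mul_le_mul_of_nonneg_left (le_abs_self t) hs).trans
        (mul_le_mul_of_nonneg_right h1 (abs_nonneg t))
    simp only
    linarith
  · have hpos : 0 < s := (le_max_right A 0).trans_lt h1
    have h2 := hA s ((le_max_left A 0).trans h1.le)
    rw [le_div_iff₀ hpos] at h2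
    simp only
    linarith

/-- Young's inequality; with `Φ̄ b ≤ Φ a = t` it gives `Φ⁻¹(t) Φ̄⁻¹(t) ≤ 2 t`. -/
theorem IsYoung.mul_le {Φ : ℝ → ℝ} (h : IsYoung Φ) {a : ℝ} (ha : 0 ≤ a) (b : ℝ) :
    a * b ≤ Φ a + associate Φ b := by
  have : a * b - Φ a ≤ associate Φ b := le_csSup (h.bddAbove b) ⟨a, ha, rfl⟩
  linarith

/-- With `t = Φ a` this is `t ≤ Φ⁻¹(t) Φ̄⁻¹(t)`. -/
theorem IsYoung.associate_div_le {Φ : ℝ → ℝ} (h : IsYoung Φ) {a : ℝ} (ha : 0 < a) :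
    associate Φ (Φ a / a) ≤ Φ a := by
  refine csSup_le ⟨_, 0, mem_Ici.2 le_rfl, rfl⟩ ?_
  rintro _ ⟨s, hs, rfl⟩
  have hs : (0 : ℝ) ≤ s := hs
  have hΦa := h.nonneg ha.le
  have hΦs := h.nonneg hs
  simp only
  rcases le_or_gt s a with h1 | h1
  · have : s * (Φ a / a) ≤ a * (Φ a / a) := mul_le_mul_of_nonneg_right h1 (by positivity)
    rw [mul_div_cancel₀ _ ha.ne'] at this
    linarith
  · have hspos : 0 < s := ha.trans h1
    have h2 : 0 ≤ 1 - a / s := by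
      rw [sub_nonneg, div_le_one hspos]
      exact h1.le
    have h3 : 0 ≤ a / s := by positivity
    have hc := h.convexOn.2 (mem_Ici.2 (le_refl (0 : ℝ))) (mem_Ici.2 hs) h2 h3 (by ring)
    simp only [smul_eq_mul, mul_zero, zero_add, h.map_zero] at hc
    rw [div_mul_cancel₀ _ hspos.ne'] at hc
    have : s * (Φ a / a) ≤ Φ s := by
      rw [← mul_div_assoc, div_le_iff₀ ha]
      calc s * Φ a ≤ s * (a / s * Φ s) := mul_le_mul_of_nonneg_left hc hs
        _ = Φ s * a := by field_simp
    linarith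

/-- The `B_p` integrability condition. -/
def IsB (p : ℝ) (Φ : ℝ → ℝ) : Prop :=
  ∃ c : ℝ, 0 < c ∧ ∫⁻ t in Ioi c, ENNReal.ofReal (Φ t / t ^ (p + 1)) < ∞

/-- The closed cube with sides parallel to the axes, lower corner `a` and side length `l`. -/
def cube {n : ℕ} (a : Fin n → ℝ) (l : ℝ) : Set (Fin n → ℝ) :=
  Icc a (fun i => a i + l)

/-- The Luxemburg average `‖f‖_{Φ,Q}`, with value `∞` if no `t` is admissible. -/
def orliczNorm {n : ℕ} (Φ : ℝ → ℝ) (Q : Set (Fin n → ℝ)) (f : (Fin n → ℝ) → ℝ) : ℝ≥0∞ :=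
  ⨅ (t : ℝ) (_ : 0 < t)
    (_ : (volume Q)⁻¹ * ∫⁻ x in Q, ENNReal.ofReal (Φ (|f x| / t)) ≤ 1), ENNReal.ofReal t

/-- The measure `w dx`. -/
def weighted {n : ℕ} (w : (Fin n → ℝ) → ℝ) : Measure (Fin n → ℝ) :=
  volume.withDensity (fun x => ENNReal.ofReal (w x))

/-- The bilinear maximal function
`BM(f,g)(x) = sup_{t>0} (2t)^{-n} ∫_{[-t,t]^n} |f(x-y) g(x+y)| dy`. -/
def BM {n : ℕ} (f g : (Fin n → ℝ) → ℂ) (x : Fin n → ℝ) : ℝ≥0∞ :=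
  ⨆ (t : ℝ) (_ : 0 < t), ENNReal.ofReal (1 / (2 * t) ^ n) *
    ∫⁻ y in Icc (fun _ : Fin n => -t) (fun _ => t), ‖f (x - y) * g (x + y)‖ₑ

end BilinearMaximal

end

/-! Hölder's inequality with exponents `r` and `s` bounds BM(f,g)(x) by the supremum, over cubes Q
centred at x, of (avg_Q |f|^r)^(1/r) (avg_Q |g|^s)^(1/s). Each such Q lies in a comparable cube of
one of 2^n adjacent dyadic grids (`BM_le_iSup_geomAvg`). It thus suffices to treat B* = sup_k B_k on
one grid, with a bound independent of the grid, where B_k(x) is this geometric mean over the level-k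
cell of x.

On one grid B_k is a geometric mean of two martingales, hence a supermartingale. A potential
argument then gives the Carleson-type estimate ∫ (B*)^p u ≤ (p+1) ∫ sup_k B_k^p E_k u, with E_k u
the cell average (`IsNested.lintegral_partialSups_rpow_mul_le`).

The integrand on the right is estimated cell by cell. The generalized Hölder inequality bounds avg
|f|^r by 2 ‖v₁^(-r/p₁)‖_φ₁ times the φ̄₁-average of |f|^r v₁^(r/p₁), similarly for g, and ψ̄ ∈
B_{p'} gives E_k u ≤ C ‖u^(1/p)‖_ψ^p. The bump condition absorbs the three weight factors and leaves
(M₁^(1/r) M₂^(1/s))^p, where M₁, M₂ are Orlicz maximal functions for φ̄₁, φ̄₂. Hölder with p/p₁ +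
p/p₂ = 1 separates them, and the B conditions bound them on L^(p₁/r) and L^(p₂/s)
(`IsNested.lintegral_iSup_orliczNorm_rpow_le`). -/

namespace BilinearMaximal

set_option linter.unusedSectionVars false

/-! ### Nested partitions -/

section Nested

variable {X ι : Type*} [MeasurableSpace X] {μ : Measure X} {π : ℕ → X → ι}

/-- The cell containing `x` of the `k`-th partition, the partition being given by its index
map `π k`. -/
def cell (π : ℕ → X → ι) (k : ℕ) (x : X) : Set X := π k ⁻¹' {π k x}

/-- The average of `w` over the cell of `x`. -/
noncomputable def cellAvg (μ : Measure X) (π : ℕ → X → ι) (k : ℕ) (w : X → ℝ≥0∞) (x : X) : ℝ≥0∞ :=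
  (μ (cell π k x))⁻¹ * ∫⁻ y in cell π k x, w y ∂μ

/-- A sequence of refining measurable partitions into cells of positive finite measure. -/
structure IsNested [MeasurableSpace ι] (μ : Measure X) (π : ℕ → X → ι) : Prop where
  measurable : ∀ k, Measurable (π k)
  refines : ∀ k, (π k).FactorsThrough (π (k + 1))
  measure_ne_zero : ∀ k x, μ (cell π k x) ≠ 0
  measure_ne_top : ∀ k x, μ (cell π k x) ≠ ∞

theorem mem_cell {k : ℕ} {x y : X} : y ∈ cell π k x ↔ π k y = π k x := Iff.rfl

theorem cell_eq {k : ℕ} {x y : X} (h : π k x = π k y) : cell π k x = cell π k y := by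
  simp [cell, h]

theorem cellAvg_factorsThrough (k : ℕ) (w : X → ℝ≥0∞) :
    (cellAvg μ π k w).FactorsThrough (π k) := by
  intro x y h
  simp [cellAvg, cell_eq h]

variable [MeasurableSpace ι] [MeasurableSingletonClass ι]

theorem IsNested.measurableSet_cell (hπ : IsNested μ π) (k : ℕ) (x : X) :
    MeasurableSet (cell π k x) :=
  hπ.measurable k (measurableSet_singleton _)

theorem IsNested.mul_cellAvg (hπ : IsNested μ π) (k : ℕ) (w : X → ℝ≥0∞) (x : X) :
    μ (cell π k x) * cellAvg μ π k w x = ∫⁻ y in cell π k x, w y ∂μ := by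
  rw [cellAvg, ← mul_assoc, ENNReal.mul_inv_cancel (hπ.measure_ne_zero k x)
    (hπ.measure_ne_top k x), one_mul]

theorem IsNested.setLIntegral_congr_cell (hπ : IsNested μ π) {k : ℕ} {g w : X → ℝ≥0∞}
    (hg : g.FactorsThrough (π k)) (hw : AEMeasurable w μ) (x : X) :
    ∫⁻ y in cell π k x, g y * w y ∂μ = g x * ∫⁻ y in cell π k x, w y ∂μ := by
  rw [← lintegral_const_mul'' _ hw.restrict]
  refine setLIntegral_congr_fun (hπ.measurableSet_cell k x) fun y hy => ?_
  simp only [hg (mem_cell.1 hy)]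

theorem IsNested.setLIntegral_cellAvg (hπ : IsNested μ π) (k : ℕ) (w : X → ℝ≥0∞) (x : X) :
    ∫⁻ y in cell π k x, cellAvg μ π k w y ∂μ = ∫⁻ y in cell π k x, w y ∂μ := by
  rw [← hπ.mul_cellAvg k w, mul_comm, ← setLIntegral_const]
  refine setLIntegral_congr_fun (hπ.measurableSet_cell k x) fun y hy => ?_
  exact cellAvg_factorsThrough k w (mem_cell.1 hy)

variable [Countable ι]

theorem IsNested.measurable_of_factorsThrough (hπ : IsNested μ π) {k : ℕ} {g : X → ℝ≥0∞}
    (hg : g.FactorsThrough (π k)) : Measurable g := by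
  have h : g = Function.extend (π k) g 0 ∘ π k := (funext (hg.extend_apply 0)).symm
  rw [h]
  exact (measurable_of_countable _).comp (hπ.measurable k)

/-- Since `g` is constant on each cell, the comparison holds cell by cell, and there are only
countably many cells. -/
theorem IsNested.lintegral_mul_le (hπ : IsNested μ π) {k : ℕ} {g a b : X → ℝ≥0∞}
    (hg : g.FactorsThrough (π k)) (ha : AEMeasurable a μ) (hb : AEMeasurable b μ)
    (h : ∀ x, ∫⁻ y in cell π k x, a y ∂μ ≤ ∫⁻ y in cell π k x, b y ∂μ) :
    ∫⁻ x, g x * a x ∂μ ≤ ∫⁻ x, g x * b x ∂μ := by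
  have key : ∀ w : X → ℝ≥0∞, ∫⁻ x, w x ∂μ = ∑' i, ∫⁻ x in π k ⁻¹' {i}, w x ∂μ := by
    intro w
    rw [← lintegral_iUnion (fun i => hπ.measurable k (measurableSet_singleton i)),
      ← preimage_iUnion, iUnion_of_singleton, preimage_univ, Measure.restrict_univ]
    intro i j hij
    exact Disjoint.preimage _ (by simpa using hij)
  rw [key, key]
  refine ENNReal.tsum_le_tsum fun i => ?_
  by_cases hi : ∃ x, π k x = i
  · obtain ⟨x, rfl⟩ := hi
    change ∫⁻ y in cell π k x, _ ∂μ ≤ ∫⁻ y in cell π k x, _ ∂μ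
    rw [hπ.setLIntegral_congr_cell hg ha, hπ.setLIntegral_congr_cell hg hb]
    exact mul_le_mul_right (h x) _
  · have : π k ⁻¹' {i} = ∅ := by
      ext x
      simpa using fun h => hi ⟨x, h⟩
    simp [this]

theorem IsNested.lintegral_mul_cellAvg (hπ : IsNested μ π) {k : ℕ} {g w : X → ℝ≥0∞}
    (hg : g.FactorsThrough (π k)) (hw : AEMeasurable w μ) :
    ∫⁻ x, g x * cellAvg μ π k w x ∂μ = ∫⁻ x, g x * w x ∂μ := by
  have hm := (hπ.measurable_of_factorsThrough (cellAvg_factorsThrough (μ := μ) k w)).aemeasurable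
    (μ := μ)
  exact le_antisymm
    (hπ.lintegral_mul_le hg hm hw fun x => (hπ.setLIntegral_cellAvg k w x).le)
    (hπ.lintegral_mul_le hg hw hm fun x => (hπ.setLIntegral_cellAvg k w x).ge)

theorem IsNested.factorsThrough_succ (hπ : IsNested μ π) {k : ℕ} {β : Type*} {g : X → β}
    (hg : g.FactorsThrough (π k)) : g.FactorsThrough (π (k + 1)) :=
  fun _ _ h => hg (hπ.refines k h)

theorem IsNested.factorsThrough_mono (hπ : IsNested μ π) {β : Type*} {g : X → β} {j k : ℕ}
    (hjk : j ≤ k) (hg : g.FactorsThrough (π j)) : g.FactorsThrough (π k) := by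
  induction k, hjk using Nat.le_induction with
  | base => exact hg
  | succ k _ ih => exact hπ.factorsThrough_succ ih

/-- Tower property: the indicator of a coarse cell is constant on the finer cells, so it is an
admissible test function at level `k + 1`. -/
theorem IsNested.setLIntegral_cellAvg_succ (hπ : IsNested μ π) (k : ℕ) {w : X → ℝ≥0∞}
    (hw : AEMeasurable w μ) (x : X) :
    ∫⁻ y in cell π k x, cellAvg μ π (k + 1) w y ∂μ = ∫⁻ y in cell π k x, w y ∂μ := by
  have hg : ((cell π k x).indicator (1 : X → ℝ≥0∞)).FactorsThrough (π (k + 1)) := by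
    refine hπ.factorsThrough_succ fun y z h => ?_
    have hyz : y ∈ cell π k x ↔ z ∈ cell π k x := by rw [mem_cell, mem_cell, h]
    by_cases hz : z ∈ cell π k x <;> simp [hyz, hz]
  have h := hπ.lintegral_mul_cellAvg hg hw
  have e : ∀ a : X → ℝ≥0∞, ∫⁻ y, (cell π k x).indicator (1 : X → ℝ≥0∞) y * a y ∂μ
      = ∫⁻ y in cell π k x, a y ∂μ := by
    intro a
    rw [← lintegral_indicator (hπ.measurableSet_cell k x)]
    congr 1 with y
    by_cases hy : y ∈ cell π k x <;> simp [hy]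
  rwa [e, e] at h

/-- The geometric mean of two cell averages. -/
noncomputable def geomAvg (μ : Measure X) (π : ℕ → X → ι) (r s : ℝ) (F G : X → ℝ≥0∞) (k : ℕ)
    (x : X) : ℝ≥0∞ :=
  cellAvg μ π k F x ^ (1 / r) * cellAvg μ π k G x ^ (1 / s)

theorem geomAvg_factorsThrough (r s : ℝ) (F G : X → ℝ≥0∞) (k : ℕ) :
    (geomAvg μ π r s F G k).FactorsThrough (π k) := by
  intro x y h
  simp only [geomAvg, cellAvg_factorsThrough k _ h]

/-- The supermartingale property: Hölder for the level `k + 1` averages on a level `k` cell,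
followed by the tower property. -/
theorem IsNested.lintegral_mul_geomAvg_succ_le (hπ : IsNested μ π) {r s : ℝ} (hr : 0 < r)
    (hs : 0 < s) (hrs : 1 / r + 1 / s = 1) {F G : X → ℝ≥0∞} (hF : AEMeasurable F μ)
    (hG : AEMeasurable G μ) {k : ℕ} {g : X → ℝ≥0∞} (hg : g.FactorsThrough (π k)) :
    ∫⁻ x, g x * geomAvg μ π r s F G (k + 1) x ∂μ ≤ ∫⁻ x, g x * geomAvg μ π r s F G k x ∂μ := by
  have hm := fun k => (hπ.measurable_of_factorsThrough
    (geomAvg_factorsThrough (μ := μ) r s F G k)).aemeasurable (μ := μ)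
  have hc := fun k w => (hπ.measurable_of_factorsThrough
    (cellAvg_factorsThrough (μ := μ) k w)).aemeasurable (μ := μ)
  refine hπ.lintegral_mul_le hg (hm _) (hm _) fun x => ?_
  have hr' : 0 ≤ 1 / r := by positivity
  have hs' : 0 ≤ 1 / s := by positivity
  calc ∫⁻ y in cell π k x, geomAvg μ π r s F G (k + 1) y ∂μ
      ≤ (∫⁻ y in cell π k x, cellAvg μ π (k + 1) F y ∂μ) ^ (1 / r) *
        (∫⁻ y in cell π k x, cellAvg μ π (k + 1) G y ∂μ) ^ (1 / s) :=
        ENNReal.lintegral_mul_norm_pow_le (hc _ _).restrict (hc _ _).restrict hr' hs' hrs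
    _ = (μ (cell π k x) * cellAvg μ π k F x) ^ (1 / r) *
        (μ (cell π k x) * cellAvg μ π k G x) ^ (1 / s) := by
        rw [hπ.setLIntegral_cellAvg_succ k hF, hπ.setLIntegral_cellAvg_succ k hG,
          hπ.mul_cellAvg, hπ.mul_cellAvg]
    _ = geomAvg μ π r s F G k x * μ (cell π k x) := by
        rw [ENNReal.mul_rpow_of_nonneg _ _ hr', ENNReal.mul_rpow_of_nonneg _ _ hs',
          mul_mul_mul_comm, ← ENNReal.rpow_add_of_nonneg _ _ hr' hs', hrs, ENNReal.rpow_one,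
          mul_comm, geomAvg]
    _ = ∫⁻ y in cell π k x, geomAvg μ π r s F G k y ∂μ := by
        rw [← setLIntegral_const]
        refine setLIntegral_congr_fun (hπ.measurableSet_cell k x) fun y hy => ?_
        exact (geomAvg_factorsThrough r s F G k (mem_cell.1 hy)).symm

end Nested

/-! ### The Carleson-type estimate -/

/-- One step of the potential when the running supremum jumps from `s` to `b`. With x = s/b, w = b^p
v and m = max h w, the claim is (1 - x^p) w ≤ (m - h) + p h (1/x - 1). Replace w by m, split m = (m
- h) + h, and use Bernoulli 1 - x^p ≤ p (1 - x) together with 1 - x ≤ 1/x - 1. -/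
theorem potential_step_real {p b s h v : ℝ} (hp : 1 ≤ p) (hs : 0 < s) (hsb : s < b)
    (hh : 0 ≤ h) :
    b ^ p * v + p * max h (b ^ p * v) + (p + 1) * h ≤
      s ^ p * v + p * (h * (b / s)) + (p + 1) * max h (b ^ p * v) := by
  have hb : 0 < b := hs.trans hsb
  set m := max h (b ^ p * v) with hm
  have h1 : h ≤ m := le_max_left _ _
  have h2 : b ^ p * v ≤ m := le_max_right _ _
  set x := s / b with hx
  have hx0 : 0 < x := by positivity
  have hx1 : x < 1 := (div_lt_one hb).2 hsb
  have hbern : 1 + p * (x - 1) ≤ x ^ p := by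
    have := one_add_mul_self_le_rpow_one_add (s := x - 1) (by linarith) hp
    simpa using this
  have hxp0 : 0 ≤ x ^ p := by positivity
  have hxp1 : x ^ p ≤ 1 := Real.rpow_le_one hx0.le hx1.le (by linarith)
  have hsx : s ^ p * v = x ^ p * (b ^ p * v) := by
    rw [hx, Real.div_rpow hs.le hb.le]
    field_simp
  have hbs : b / s = 1 / x := by rw [hx]; field_simp
  rw [hsx, hbs]
  have hinv : 2 - x ≤ 1 / x := by
    rw [le_div_iff₀ hx0]
    nlinarith [sq_nonneg (x - 1)]
  have e1 : (1 - x ^ p) * (b ^ p * v) ≤ (1 - x ^ p) * m :=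
    mul_le_mul_of_nonneg_left h2 (by linarith)
  have e2 : (1 - x ^ p) * (m - h) ≤ m - h :=
    mul_le_of_le_one_left (by linarith) (by linarith)
  have e3 : (1 - x ^ p) * h ≤ p * (1 - x) * h :=
    mul_le_mul_of_nonneg_right (by linarith) hh
  have e4 : p * (h * (2 - x)) ≤ p * (h * (1 / x)) := by gcongr
  nlinarith

/-- The same step with values in [0, ∞] and with or without a jump; each negative term has been
moved across to avoid subtraction. -/
theorem potential_step {p : ℝ} (hp : 1 ≤ p) {b s h v : ℝ≥0∞} (hsh : s = 0 → h = 0) :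
    (s ⊔ b) ^ p * v + ENNReal.ofReal p * ((h ⊔ b ^ p * v) * (b / (s ⊔ b))) +
        (ENNReal.ofReal p + 1) * h ≤
      s ^ p * v + ENNReal.ofReal p * (h * (b / s)) +
        (ENNReal.ofReal p + 1) * (h ⊔ b ^ p * v) := by
  have hp0 : 0 < p := by linarith
  rcases le_or_gt b s with hbs | hbs
  -- No jump: if `h` grows by `d`, the left side gains p d (b/s) ≤ p d and the right side gains
  -- (p+1) d.
  · rw [sup_eq_left.2 hbs]
    obtain ⟨d, hd⟩ := exists_add_of_le (le_sup_left : h ≤ h ⊔ b ^ p * v)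
    rw [hd]
    have hx : b / s ≤ 1 := ENNReal.div_le_of_le_mul (by simpa using hbs)
    calc s ^ p * v + ENNReal.ofReal p * ((h + d) * (b / s)) + (ENNReal.ofReal p + 1) * h
        = s ^ p * v + ENNReal.ofReal p * (h * (b / s)) + ((ENNReal.ofReal p + 1) * h +
            (ENNReal.ofReal p * d * (b / s))) := by ring
      _ ≤ s ^ p * v + ENNReal.ofReal p * (h * (b / s)) + ((ENNReal.ofReal p + 1) * h +
            ((ENNReal.ofReal p + 1) * d * 1)) := by gcongr; exact le_self_add
      _ = _ := by ring
  rw [sup_eq_right.2 hbs.le]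
  have hb0 : b ≠ 0 := (zero_le.trans_lt hbs).ne'
  have hbv : b ^ p * v ≤ h ⊔ b ^ p * v := le_sup_right
  have hzero : h = 0 → b ^ p * v + ENNReal.ofReal p * ((h ⊔ b ^ p * v) * (b / b)) +
        (ENNReal.ofReal p + 1) * h ≤
      s ^ p * v + ENNReal.ofReal p * (h * (b / s)) +
        (ENNReal.ofReal p + 1) * (h ⊔ b ^ p * v) := by
    intro h0
    calc b ^ p * v + ENNReal.ofReal p * ((h ⊔ b ^ p * v) * (b / b)) +
        (ENNReal.ofReal p + 1) * h
        ≤ (h ⊔ b ^ p * v) + ENNReal.ofReal p * ((h ⊔ b ^ p * v) * 1) + 0 := by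
          gcongr
          · exact ENNReal.div_self_le_one
          · simp [h0]
      _ = (ENNReal.ofReal p + 1) * (h ⊔ b ^ p * v) := by ring
      _ ≤ _ := le_add_self
  rcases eq_or_ne h 0 with h0 | h0
  · exact hzero h0
  have hs0 : s ≠ 0 := fun h => h0 (hsh h)
  rcases eq_or_ne (h ⊔ b ^ p * v) ∞ with hm | hm
  · rw [hm, ENNReal.mul_top (by positivity)]
    simp
  have hP0 : ENNReal.ofReal p ≠ 0 := by simpa using hp0
  rcases eq_or_ne b ∞ with hb | hb
  · have : ENNReal.ofReal p * (h * (b / s)) = ∞ := by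
      rw [hb, ENNReal.top_div_of_lt_top (hb ▸ hbs), ENNReal.mul_top h0, ENNReal.mul_top hP0]
    simp [this]
  have hht : h ≠ ∞ := ne_top_of_le_ne_top hm le_sup_left
  have hvt : v ≠ ∞ := by
    rintro rfl
    refine ne_top_of_le_ne_top hm hbv (ENNReal.mul_top ?_)
    simp [hb0, hp0, hb]
  have hst : s ≠ ∞ := (hbs.trans_le le_top).ne
  lift b to ℝ≥0 using hb
  lift s to ℝ≥0 using hst
  lift h to ℝ≥0 using hht
  lift v to ℝ≥0 using hvt
  have hs0' : s ≠ 0 := by exact_mod_cast hs0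
  have hb0' : b ≠ 0 := by exact_mod_cast hb0
  have key := potential_step_real (p := p) (b := b) (s := s) (h := h) (v := v) hp
    (by positivity) (by exact_mod_cast hbs) h.2
  rw [← ENNReal.coe_div hs0', ← ENNReal.coe_div hb0', ← ENNReal.coe_rpow_of_nonneg _ hp0.le,
    ← ENNReal.coe_rpow_of_nonneg _ hp0.le, div_self hb0', ENNReal.ofReal]
  have hpc : ((p.toNNReal : ℝ≥0) : ℝ) = p := Real.coe_toNNReal _ hp0.le
  norm_cast
  rw [← NNReal.coe_le_coe]
  push_cast
  rw [hpc]
  simpa using key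

section Carleson

variable {X ι : Type*} [MeasurableSpace X] {μ : Measure X} {π : ℕ → X → ι}
  [MeasurableSpace ι] [MeasurableSingletonClass ι] [Countable ι]

theorem IsNested.factorsThrough_partialSups (hπ : IsNested μ π) {a : ℕ → X → ℝ≥0∞}
    (ha : ∀ k, (a k).FactorsThrough (π k)) (K : ℕ) :
    (fun x => partialSups (fun k => a k x) K).FactorsThrough (π K) := by
  induction K with
  | zero => intro x y h; simpa using ha 0 h
  | succ K ih =>
    intro x y h
    simp only [partialSups_add_one]
    rw [ha _ h]
    congr 1
    exact ih (hπ.refines K h)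

/-- If `B` is the geometric mean of two martingales, then the integral of `(sup B) ^ p * u` is
controlled by that of the supremum of `B ^ p` times the averages of `u`. -/
theorem IsNested.lintegral_partialSups_rpow_mul_le (hπ : IsNested μ π) {p r s : ℝ} (hp : 1 ≤ p)
    (hr : 0 < r) (hs : 0 < s) (hrs : 1 / r + 1 / s = 1) {F G u : X → ℝ≥0∞}
    (hF : AEMeasurable F μ) (hG : AEMeasurable G μ) (hu : AEMeasurable u μ) (K : ℕ) :
    ∫⁻ x, partialSups (fun k => geomAvg μ π r s F G k x) K ^ p * u x ∂μ ≤
      (ENNReal.ofReal p + 1) * ∫⁻ x, partialSups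
        (fun k => geomAvg μ π r s F G k x ^ p * cellAvg μ π k u x) K ∂μ := by
  have hp0 : 0 < p := by linarith
  set B := geomAvg μ π r s F G with hBdef
  set P := ENNReal.ofReal p
  set S : ℕ → X → ℝ≥0∞ := fun K x => partialSups (fun k => B k x) K with hS
  set H : ℕ → X → ℝ≥0∞ := fun K x => partialSups (fun k => B k x ^ p * cellAvg μ π k u x) K
    with hH
  have hBf : ∀ k, (B k).FactorsThrough (π k) := geomAvg_factorsThrough r s F G
  have hSf : ∀ k, (S k).FactorsThrough (π k) := fun k => hπ.factorsThrough_partialSups hBf k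
  have hHf : ∀ k, (H k).FactorsThrough (π k) := fun k =>
    hπ.factorsThrough_partialSups (a := fun k x => B k x ^ p * cellAvg μ π k u x)
      (fun k x y h => by simp only [hBf k h, cellAvg_factorsThrough k u h]) k
  have meas : ∀ {k : ℕ} {g : X → ℝ≥0∞}, g.FactorsThrough (π k) → Measurable g :=
    fun h => hπ.measurable_of_factorsThrough h
  have hratio : ∀ k, ∀ j, (fun x => H k x * (B k x / S j x)).FactorsThrough (π (max k j)) := by
    intro k j x y h
    have e1 := hπ.factorsThrough_mono (le_max_left k j) (hHf k) h
    have e2 := hπ.factorsThrough_mono (le_max_left k j) (hBf k) h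
    have e3 := hπ.factorsThrough_mono (le_max_right k j) (hSf j) h
    simp only [e1, e2, e3]
  have hSu : ∀ k j, k ≤ j → ∫⁻ x, S k x ^ p * u x ∂μ
      = ∫⁻ x, S k x ^ p * cellAvg μ π j u x ∂μ := by
    intro k j hkj
    refine (hπ.lintegral_mul_cellAvg (k := j) (g := fun x => S k x ^ p) ?_ hu).symm
    intro x y h
    simp only [hπ.factorsThrough_mono hkj (hSf k) h]
  -- The potential ∫ S^p u + P ∫ H B/S - (P+1) ∫ H starts nonpositive and does not increase with
  -- `K`. Finiteness of ∫ H is what permits cancelling (P+1) ∫ H in the inductive step.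
  have main : ∫⁻ x, H K x ∂μ ≠ ∞ → ∫⁻ x, S K x ^ p * u x ∂μ +
      P * ∫⁻ x, H K x * (B K x / S K x) ∂μ ≤ (P + 1) * ∫⁻ x, H K x ∂μ := by
    induction K with
    | zero =>
      intro _
      rw [hSu 0 0 le_rfl, add_comm P 1, add_mul, one_mul]
      refine add_le_add ?_ ?_
      · simp [hS, hH]
      · gcongr with x
        simp only [hS, hH, partialSups_zero]
        exact mul_le_of_le_one_right' ENNReal.div_self_le_one
    | succ K ih =>
      intro hfin
      have hmono : ∀ x, H K x ≤ H (K + 1) x := fun x => (partialSups _).monotone (Nat.le_succ K)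
      have hfinK : ∫⁻ x, H K x ∂μ ≠ ∞ := ne_top_of_le_ne_top hfin (lintegral_mono hmono)
      have ih := ih hfinK
      have hPtop : P + 1 ≠ ∞ := by simp [P]
      have hstep : ∀ x, S (K + 1) x ^ p * cellAvg μ π (K + 1) u x +
          P * (H (K + 1) x * (B (K + 1) x / S (K + 1) x)) + (P + 1) * H K x ≤
          S K x ^ p * cellAvg μ π (K + 1) u x + P * (H K x / S K x * B (K + 1) x) +
          (P + 1) * H (K + 1) x := by
        intro x
        have e : H K x / S K x * B (K + 1) x = H K x * (B (K + 1) x / S K x) := by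
          simp only [div_eq_mul_inv]; ring
        rw [e]
        simp only [hS, hH, partialSups_add_one]
        refine potential_step hp fun h0 => ?_
        refine le_antisymm (partialSups_le _ _ _ fun k hk => ?_) zero_le
        have : B k x = 0 := le_antisymm (h0 ▸ le_partialSups_of_le (fun k => B k x) hk) zero_le
        simp [this, hp0]
      have hcm := fun k => meas (cellAvg_factorsThrough (μ := μ) (π := π) k u)
      have hint := lintegral_mono (μ := μ) hstep
      have m1 : Measurable fun x => S (K + 1) x ^ p * cellAvg μ π (K + 1) u x :=
        ((meas (hSf _)).pow_const p).mul (hcm _)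
      have m2 : Measurable fun x => H (K + 1) x * (B (K + 1) x / S (K + 1) x) :=
        meas (hratio (K + 1) (K + 1))
      have m3 : Measurable fun x => S K x ^ p * cellAvg μ π (K + 1) u x :=
        ((meas (hSf _)).pow_const p).mul (hcm _)
      have m4 : Measurable fun x => H K x / S K x * B (K + 1) x :=
        ((meas (hHf _)).div (meas (hSf _))).mul (meas (hBf _))
      have m12 : Measurable fun x => S (K + 1) x ^ p * cellAvg μ π (K + 1) u x +
          P * (H (K + 1) x * (B (K + 1) x / S (K + 1) x)) := m1.add (m2.const_mul P)
      have m34 : Measurable fun x => S K x ^ p * cellAvg μ π (K + 1) u x +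
          P * (H K x / S K x * B (K + 1) x) := m3.add (m4.const_mul P)
      rw [lintegral_add_left m12, lintegral_add_left m1,
        lintegral_add_left m34, lintegral_add_left m3,
        lintegral_const_mul _ m2, lintegral_const_mul _ m4, lintegral_const_mul _ (meas (hHf _)),
        lintegral_const_mul _ (meas (hHf _)), ← hSu (K + 1) (K + 1) le_rfl,
        ← hSu K (K + 1) (Nat.le_succ K)] at hint
      -- The factor H/S is determined at level `K`, so the supermartingale property replaces B (K+1)
      -- by B K.
      have hsuper : ∫⁻ x, H K x / S K x * B (K + 1) x ∂μ ≤ ∫⁻ x, H K x / S K x * B K x ∂μ :=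
        hπ.lintegral_mul_geomAvg_succ_le hr hs hrs hF hG
          (fun x y h => by simp only [hHf K h, hSf K h])
      have e : ∀ x, H K x / S K x * B K x = H K x * (B K x / S K x) := fun x => by
        simp only [div_eq_mul_inv]; ring
      simp only [e] at hsuper
      refine (ENNReal.add_le_add_iff_right (ENNReal.mul_ne_top hPtop hfinK)).1 (hint.trans ?_)
      rw [add_comm ((P + 1) * ∫⁻ x, H (K + 1) x ∂μ)]
      gcongr
      exact le_trans (by gcongr) ih
  rcases eq_or_ne (∫⁻ x, H K x ∂μ) ∞ with h | h
  · rw [h, ENNReal.mul_top (by simp)]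
    exact le_top
  · exact le_self_add.trans (main h)

end Carleson

/-! ### Orlicz maximal functions on nested partitions -/

/-- Stopping at the first level: the part of `A k` not covered by earlier levels is still a union of
level `k` cells, and these parts are disjoint, so the cell estimates add up. -/
theorem IsNested.measure_iUnion_le_lintegral {X ι : Type*} [MeasurableSpace X] {μ : Measure X}
    {π : ℕ → X → ι} [MeasurableSpace ι] [MeasurableSingletonClass ι] [Countable ι]
    (hπ : IsNested μ π) {A : ℕ → Set X} (hA : ∀ k, (· ∈ A k).FactorsThrough (π k))
    {g : X → ℝ≥0∞} (hg : AEMeasurable g μ)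
    (h : ∀ k, ∀ x ∈ A k, μ (cell π k x) ≤ ∫⁻ y in cell π k x, g y ∂μ) :
    μ (⋃ k, A k) ≤ ∫⁻ x, g x ∂μ := by
  have hD : ∀ k, (· ∈ disjointed A k).FactorsThrough (π k) := by
    intro k x y hxy
    have e : ∀ j ≤ k, (x ∈ A j ↔ y ∈ A j) := fun j hj =>
      (hπ.factorsThrough_mono hj (hA j) hxy).to_iff
    simp only [disjointed_eq_inter_compl, mem_inter_iff, mem_iInter, mem_compl_iff, eq_iff_iff]
    rw [e k le_rfl]
    refine and_congr_right fun _ => forall_congr' fun j => forall_congr' fun hj => ?_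
    rw [e j hj.le]
  have hind : ∀ {k : ℕ} {S : Set X}, (· ∈ S).FactorsThrough (π k) →
      (S.indicator (1 : X → ℝ≥0∞)).FactorsThrough (π k) := by
    intro k S hS x y hxy
    have e : x ∈ S ↔ y ∈ S := (hS hxy).to_iff
    by_cases hy : y ∈ S <;> simp [e, hy]
  have hmeas : ∀ {k : ℕ} {S : Set X}, (· ∈ S).FactorsThrough (π k) → MeasurableSet S := by
    intro k S hS
    have := hπ.measurable_of_factorsThrough (hind hS)
    simpa using (measurable_indicator_const_iff (1 : ℝ≥0∞)).1 this
  rw [← iUnion_disjointed]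
  refine (measure_iUnion_le _).trans ?_
  calc ∑' k, μ (disjointed A k)
      ≤ ∑' k, ∫⁻ x in disjointed A k, g x ∂μ := ENNReal.tsum_le_tsum fun k => ?_
    _ = ∫⁻ x in ⋃ k, disjointed A k, g x ∂μ :=
        (lintegral_iUnion (fun k => hmeas (hD k)) (disjoint_disjointed A) g).symm
    _ ≤ ∫⁻ x, g x ∂μ := setLIntegral_le_lintegral _ _
  have hAm := hmeas (hA k)
  have hDm := hmeas (hD k)
  -- Taking the indicator of `A k` for `a`, instead of 1, makes the cell comparison trivial on cells
  -- outside `A k`, where no lower bound for ∫ g is available.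
  have key := hπ.lintegral_mul_le (k := k) (g := (disjointed A k).indicator 1)
    (a := (A k).indicator 1) (b := g) (hind (hD k))
    (measurable_one.indicator hAm).aemeasurable hg fun x => ?_
  · calc μ (disjointed A k)
        = ∫⁻ x, (disjointed A k).indicator 1 x * (A k).indicator 1 x ∂μ := by
          rw [← lintegral_indicator_one hDm]
          congr 1 with x
          by_cases hx : x ∈ disjointed A k
          · simp [hx, disjointed_subset A k hx]
          · simp [hx]
      _ ≤ _ := key
      _ = ∫⁻ x in disjointed A k, g x ∂μ := by
          rw [← lintegral_indicator hDm]
          congr 1 with x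
          by_cases hx : x ∈ disjointed A k <;> simp [hx]
  · by_cases hx : x ∈ A k
    · refine le_trans ?_ (h k x hx)
      calc ∫⁻ y in cell π k x, (A k).indicator 1 y ∂μ ≤ ∫⁻ y in cell π k x, 1 ∂μ :=
            lintegral_mono fun y => indicator_le_self' (fun _ _ => zero_le) y
        _ = μ (cell π k x) := by simp
    · refine le_of_eq_of_le ?_ zero_le
      rw [setLIntegral_congr_fun (g := 0) (hπ.measurableSet_cell k x) fun y hy => ?_]
      · simp
      · have : y ∉ A k := fun hy' => hx ((hA k (mem_cell.1 hy)).to_iff.1 hy')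
        simp [this]

theorem rpow_le_lintegral_layer {q : ℝ} (hq : 1 ≤ q) (a : ℝ≥0∞) :
    a ^ q ≤ ∫⁻ l in Ioi (0 : ℝ), ENNReal.ofReal (q * l ^ (q - 1)) *
      {l | ENNReal.ofReal l < a}.indicator 1 l := by
  have hq0 : 0 < q := by linarith
  -- The layer-cake formula at finite heights; afterwards b = a if `a` is finite, and b^q = c is
  -- arbitrary if a = ∞.
  have fin : ∀ b : ℝ, 0 ≤ b → ENNReal.ofReal b ≤ a → ENNReal.ofReal b ^ q ≤
      ∫⁻ l in Ioi (0 : ℝ), ENNReal.ofReal (q * l ^ (q - 1)) *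
        {l | ENNReal.ofReal l < a}.indicator 1 l := by
    intro b hb hba
    have h1 : ENNReal.ofReal b ^ q = ∫⁻ l in Ioc 0 b, ENNReal.ofReal (q * l ^ (q - 1)) := by
      have hint : IntervalIntegrable (fun l : ℝ => q * l ^ (q - 1)) volume 0 b :=
        (intervalIntegral.intervalIntegrable_rpow' (by linarith)).const_mul q
      rw [← ofReal_integral_eq_lintegral_ofReal, ← intervalIntegral.integral_of_le hb,
        intervalIntegral.integral_const_mul, integral_rpow (Or.inl (by linarith)),
        ENNReal.ofReal_rpow_of_nonneg hb hq0.le]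
      · congr 1
        rw [sub_add_cancel, Real.zero_rpow hq0.ne']
        field_simp
        ring
      · exact (intervalIntegrable_iff_integrableOn_Ioc_of_le hb).1 hint
      · filter_upwards [ae_restrict_mem measurableSet_Ioc] with l hl
        have := hl.1
        positivity
    rw [h1, ← restrict_Ioo_eq_restrict_Ioc]
    calc ∫⁻ l in Ioo 0 b, ENNReal.ofReal (q * l ^ (q - 1))
        ≤ ∫⁻ l in Ioo 0 b, ENNReal.ofReal (q * l ^ (q - 1)) *
            {l | ENNReal.ofReal l < a}.indicator 1 l := by
          refine setLIntegral_mono' measurableSet_Ioo fun l hl => ?_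
          have : ENNReal.ofReal l < a :=
            ((ENNReal.ofReal_lt_ofReal_iff (hl.1.trans hl.2)).2 hl.2).trans_le hba
          simp [this]
      _ ≤ _ := lintegral_mono_set Ioo_subset_Ioi_self
  rcases eq_or_ne a ∞ with rfl | ha
  · rw [ENNReal.top_rpow_of_pos hq0, top_le_iff]
    refine ENNReal.eq_top_of_forall_nnreal_le fun c => ?_
    have := fin ((c : ℝ) ^ (1 / q)) (by positivity) le_top
    rwa [ENNReal.ofReal_rpow_of_nonneg (by positivity) hq0.le, ← Real.rpow_mul c.coe_nonneg,
      one_div_mul_cancel hq0.ne', Real.rpow_one, ENNReal.ofReal_coe_nnreal] at this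
  · have := fin a.toReal ENNReal.toReal_nonneg (ENNReal.ofReal_toReal ha).le
    rwa [ENNReal.ofReal_toReal ha] at this

/-- The substitution l = H/t turns ε l < H into t > ε and l^(q-1) dl into H^q t^(-q-1) dt, which is
where the B_q integral comes from. -/
theorem lintegral_dilate_eq {q ε H : ℝ} (hq : 1 ≤ q) (hε : 0 < ε) (hH : 0 ≤ H) (Φ : ℝ → ℝ) :
    ∫⁻ l in Ioi (0 : ℝ), ENNReal.ofReal (q * l ^ (q - 1)) *
        {l | ε * l < H}.indicator (fun l => 2 * ENNReal.ofReal (Φ (H / l))) l =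
      ENNReal.ofReal (2 * q) * (∫⁻ t in Ioi ε, ENNReal.ofReal (Φ t / t ^ (q + 1))) *
        ENNReal.ofReal H ^ q := by
  have hq0 : 0 < q := by linarith
  rcases hH.eq_or_lt with rfl | hH
  · rw [ENNReal.ofReal_zero, ENNReal.zero_rpow_of_pos hq0, mul_zero]
    rw [setLIntegral_congr_fun (g := 0) measurableSet_Ioi]
    · simp
    · intro l hl
      have h0 : ¬ ε * l < 0 := not_lt.2 (mul_nonneg hε.le (le_of_lt hl))
      simp [h0]
  have himg : (fun t => H / t) '' Ioi ε = Ioo 0 (H / ε) := by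
    ext l
    constructor
    · rintro ⟨t, ht, rfl⟩
      have ht0 : 0 < t := hε.trans ht
      exact ⟨by positivity, div_lt_div_of_pos_left hH hε ht⟩
    · intro hl
      refine ⟨H / l, ?_, by have := hl.1; field_simp⟩
      rw [mem_Ioi, lt_div_iff₀ hl.1, mul_comm]
      exact (lt_div_iff₀ hε).1 hl.2
  have hset : ∫⁻ l in Ioi (0 : ℝ), ENNReal.ofReal (q * l ^ (q - 1)) *
        {l | ε * l < H}.indicator (fun l => 2 * ENNReal.ofReal (Φ (H / l))) l =
      ∫⁻ l in Ioo 0 (H / ε), ENNReal.ofReal (q * l ^ (q - 1)) *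
        (2 * ENNReal.ofReal (Φ (H / l))) := by
    rw [← lintegral_indicator measurableSet_Ioi, ← lintegral_indicator measurableSet_Ioo]
    congr 1 with l
    by_cases h0 : 0 < l
    · by_cases h1 : ε * l < H
      · have : l < H / ε := by rwa [lt_div_iff₀ hε, mul_comm]
        simp [h0, h1, this]
      · have : ¬ l < H / ε := by rwa [lt_div_iff₀ hε, mul_comm]
        simp [h0, h1, this]
    · simp [h0]
  rw [hset, ← himg, lintegral_image_eq_lintegral_abs_deriv_mul (f' := fun t => -H / t ^ 2)
    measurableSet_Ioi, mul_right_comm, ← lintegral_const_mul' _ _ (by finiteness)]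
  · refine setLIntegral_congr_fun measurableSet_Ioi fun t ht => ?_
    have ht0 : 0 < t := hε.trans ht
    rw [ENNReal.ofReal_rpow_of_nonneg hH.le hq0.le, ← ENNReal.ofReal_ofNat 2,
      ← ENNReal.ofReal_mul (by positivity), ← ENNReal.ofReal_mul (by positivity),
      ← ENNReal.ofReal_mul (by positivity), ← ENNReal.ofReal_mul (by positivity),
      ← ENNReal.ofReal_mul (by positivity)]
    congr 1
    have e1 : H / (H / t) = t := by field_simp
    have e2 : (H / t) ^ (q - 1) = H ^ q / H / (t ^ (q + 1) / t ^ 2) := by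
      rw [Real.div_rpow hH.le ht0.le, Real.rpow_sub_one hH.ne', Real.rpow_sub_one ht0.ne',
        Real.rpow_add_one ht0.ne']
      field_simp
    have e3 : |-H / t ^ 2| = H / t ^ 2 := by
      rw [neg_div, abs_neg, abs_of_pos (by positivity)]
    rw [e1, e2, e3]
    have : 0 < t ^ (q + 1) := by positivity
    field_simp
  · intro t ht
    have ht0 : t ≠ 0 := (hε.trans ht).ne'
    have := ((hasDerivAt_const t H).div (hasDerivAt_id t) ht0).hasDerivWithinAt (s := Ioi ε)
    simp only [zero_mul, id_eq, mul_one, zero_sub] at this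
    exact this
  · intro a ha b hb hab
    have ha0 : a ≠ 0 := (hε.trans ha).ne'
    have hb0 : b ≠ 0 := (hε.trans hb).ne'
    simp only at hab
    field_simp at hab
    exact hab.symm

section Maximal

variable {n : ℕ} {ι : Type*} [MeasurableSpace ι] [MeasurableSingletonClass ι] [Countable ι]
  {π : ℕ → (Fin n → ℝ) → ι}

/-- Weak-type bound. On a cell with Luxemburg average above `l`, the mean of Φ(|h|/l) exceeds 1.
Points with |h| ≤ ε l contribute at most 1/2, so the others carry at least half; hence the factor 2.
-/
theorem IsNested.measure_lt_iSup_orliczNorm_le (hπ : IsNested volume π) {Φ : ℝ → ℝ}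
    (hΦm : Monotone Φ) {ε : ℝ} (hΦε : Φ ε ≤ 1 / 2) {h : (Fin n → ℝ) → ℝ}
    (hh : AEMeasurable h volume) {l : ℝ} (hl : 0 < l) :
    volume {x | ENNReal.ofReal l < ⨆ k, orliczNorm Φ (cell π k x) h} ≤
      ∫⁻ x, {l | ε * l < |h x|}.indicator (fun l => 2 * ENNReal.ofReal (Φ (|h x| / l))) l := by
  have hset : {x | ENNReal.ofReal l < ⨆ k, orliczNorm Φ (cell π k x) h} =
      ⋃ k, {x | ENNReal.ofReal l < orliczNorm Φ (cell π k x) h} := by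
    ext x
    simp [lt_iSup_iff]
  have hgm : AEMeasurable (fun x => ENNReal.ofReal (Φ (|h x| / l))) volume :=
    (hΦm.measurable.comp_aemeasurable (hh.abs.div_const l)).ennreal_ofReal
  have hind : ∀ x, {l | ε * l < |h x|}.indicator (fun l => 2 * ENNReal.ofReal (Φ (|h x| / l))) l =
      2 * {x | ε * l < |h x|}.indicator (fun x => ENNReal.ofReal (Φ (|h x| / l))) x := by
    intro x
    by_cases hx : ε * l < |h x| <;> simp [hx]
  simp only [hind]
  have hgi : AEMeasurable ({x | ε * l < |h x|}.indicator
      (fun x => ENNReal.ofReal (Φ (|h x| / l)))) volume :=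
    hgm.indicator₀ (nullMeasurableSet_lt aemeasurable_const hh.abs)
  rw [hset]
  refine hπ.measure_iUnion_le_lintegral (fun k x y hxy => by simp [cell_eq hxy])
    (hgi.const_mul 2) fun k x hx => ?_
  set Q := cell π k x
  have hQ0 : volume Q ≠ 0 := hπ.measure_ne_zero k x
  have hQt : volume Q ≠ ∞ := hπ.measure_ne_top k x
  have h1 : 1 < (volume Q)⁻¹ * ∫⁻ x in Q, ENNReal.ofReal (Φ (|h x| / l)) := by
    by_contra hcon
    exact absurd (by simpa using hx : ENNReal.ofReal l < orliczNorm Φ Q h)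
      (not_lt.2 (iInf_le_of_le l (iInf_le_of_le hl
      (iInf_le_of_le (not_lt.1 hcon) le_rfl))))
  have h2 : volume Q ≤ ∫⁻ x in Q, ENNReal.ofReal (Φ (|h x| / l)) := by
    rw [← ENNReal.div_eq_inv_mul, ENNReal.lt_div_iff_mul_lt (Or.inl hQ0) (Or.inl hQt),
      one_mul] at h1
    exact h1.le
  have h3 : ∫⁻ x in Q, ENNReal.ofReal (Φ (|h x| / l)) ≤ volume Q / 2 + ∫⁻ x in Q,
      {x | ε * l < |h x|}.indicator (fun x => ENNReal.ofReal (Φ (|h x| / l))) x := by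
    have : volume Q / 2 = ∫⁻ x in Q, (1 / 2 : ℝ≥0∞) := by
      rw [setLIntegral_const, one_div, mul_comm, div_eq_mul_inv]
    rw [this, ← lintegral_add_left measurable_const]
    refine lintegral_mono fun y => ?_
    by_cases hy : ε * l < |h y|
    · simp [hy]
    · have h4 : Φ (|h y| / l) ≤ 1 / 2 :=
        (hΦm ((div_le_iff₀ hl).2 (not_lt.1 hy))).trans hΦε
      have : ENNReal.ofReal (Φ (|h y| / l)) ≤ 1 / 2 := by
        refine (ENNReal.ofReal_le_ofReal h4).trans (le_of_eq ?_)
        rw [ENNReal.ofReal_div_of_pos (by norm_num)]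
        simp
      simpa [hy] using this
  rw [lintegral_const_mul'' _ hgi.restrict]
  have h5 := h2.trans h3
  have hhalf : volume Q / 2 ≠ ∞ := ENNReal.div_ne_top hQt (by simp)
  nth_rewrite 1 [← ENNReal.add_halves (volume Q)] at h5
  have h6 := (ENNReal.add_le_add_iff_left hhalf).1 h5
  calc volume Q = 2 * (volume Q / 2) := (ENNReal.mul_div_cancel (by simp) (by simp)).symm
    _ ≤ _ := by gcongr

/-- Layer cake, the weak-type bound at each height, Tonelli, and the substitution in the inner
integral. -/
theorem IsNested.lintegral_iSup_orliczNorm_rpow_le (hπ : IsNested volume π) {Φ : ℝ → ℝ}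
    (hΦm : Monotone Φ) {ε : ℝ} (hε : 0 < ε) (hΦε : Φ ε ≤ 1 / 2) {q : ℝ}
    (hq : 1 ≤ q) {h : (Fin n → ℝ) → ℝ} (hh : AEMeasurable h volume) :
    ∫⁻ x, (⨆ k, orliczNorm Φ (cell π k x) h) ^ q ≤
      ENNReal.ofReal (2 * q) * (∫⁻ t in Ioi ε, ENNReal.ofReal (Φ t / t ^ (q + 1))) *
        ∫⁻ x, ENNReal.ofReal |h x| ^ q := by
  set M : (Fin n → ℝ) → ℝ≥0∞ := fun x => ⨆ k, orliczNorm Φ (cell π k x) h with hM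
  have hMm : Measurable M := by
    refine Measurable.iSup fun k => hπ.measurable_of_factorsThrough (k := k) ?_
    intro x y hxy
    simp only [cell_eq hxy]
  have hqm : Measurable fun l : ℝ => ENNReal.ofReal (q * l ^ (q - 1)) := by fun_prop
  calc ∫⁻ x, M x ^ q
      ≤ ∫⁻ x, ∫⁻ l in Ioi (0 : ℝ), ENNReal.ofReal (q * l ^ (q - 1)) *
          {l | ENNReal.ofReal l < M x}.indicator 1 l :=
        lintegral_mono fun x => rpow_le_lintegral_layer hq (M x)
    _ = ∫⁻ l in Ioi (0 : ℝ), ∫⁻ x, ENNReal.ofReal (q * l ^ (q - 1)) *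
          {l | ENNReal.ofReal l < M x}.indicator 1 l := by
        refine lintegral_lintegral_swap (Measurable.aemeasurable ?_)
        refine (hqm.comp measurable_snd).mul ?_
        have hS : MeasurableSet {z : (Fin n → ℝ) × ℝ | ENNReal.ofReal z.2 < M z.1} :=
          measurableSet_lt measurable_snd.ennreal_ofReal (hMm.comp measurable_fst)
        exact measurable_one.indicator hS
    _ ≤ ∫⁻ l in Ioi (0 : ℝ), ∫⁻ x, ENNReal.ofReal (q * l ^ (q - 1)) *
          {l | ε * l < |h x|}.indicator (fun l => 2 * ENNReal.ofReal (Φ (|h x| / l))) l := by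
        refine setLIntegral_mono' measurableSet_Ioi fun l hl => ?_
        rw [lintegral_const_mul' _ _ (by finiteness), lintegral_const_mul' _ _ (by finiteness)]
        refine mul_le_mul_right ?_ _
        refine le_trans (le_of_eq ?_) (hπ.measure_lt_iSup_orliczNorm_le hΦm hΦε hh hl)
        rw [← lintegral_indicator_one (measurableSet_lt measurable_const hMm)]
        rfl
    _ = ∫⁻ x, ∫⁻ l in Ioi (0 : ℝ), ENNReal.ofReal (q * l ^ (q - 1)) *
          {l | ε * l < |h x|}.indicator (fun l => 2 * ENNReal.ofReal (Φ (|h x| / l))) l := by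
        have hh' : AEMeasurable (fun z : (Fin n → ℝ) × ℝ => |h z.1|)
            (volume.prod (volume.restrict (Ioi (0 : ℝ)))) :=
          (hh.comp_quasiMeasurePreserving Measure.quasiMeasurePreserving_fst).abs
        refine (lintegral_lintegral_swap ?_).symm
        refine (hqm.comp measurable_snd).aemeasurable.mul ?_
        have hS : NullMeasurableSet {z : (Fin n → ℝ) × ℝ | ε * z.2 < |h z.1|}
            (volume.prod (volume.restrict (Ioi (0 : ℝ)))) :=
          nullMeasurableSet_lt (measurable_snd.const_mul ε).aemeasurable hh'
        exact AEMeasurable.indicator₀ (f := fun z : (Fin n → ℝ) × ℝ =>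
          2 * ENNReal.ofReal (Φ (|h z.1| / z.2))) (AEMeasurable.const_mul
            (hΦm.measurable.comp_aemeasurable (hh'.div measurable_snd.aemeasurable)).ennreal_ofReal
            2) hS
    _ = _ := by
        simp only [lintegral_dilate_eq hq hε (abs_nonneg _) Φ]
        exact lintegral_const_mul'' _ (hh.abs.ennreal_ofReal.pow_const q)

end Maximal

/-! ### Young functions and Luxemburg averages -/

theorem IsYoung.associate_mono {Φ : ℝ → ℝ} (h : IsYoung Φ) : Monotone (associate Φ) := by
  intro a b hab
  refine csSup_le ⟨_, 0, mem_Ici.2 le_rfl, rfl⟩ ?_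
  rintro _ ⟨s, hs, rfl⟩
  refine le_trans ?_ (le_csSup (h.bddAbove b) ⟨s, hs, rfl⟩)
  have : s * a ≤ s * b := mul_le_mul_of_nonneg_left hab hs
  simpa using this

theorem IsYoung.associate_nonneg {Φ : ℝ → ℝ} (h : IsYoung Φ) (t : ℝ) : 0 ≤ associate Φ t :=
  le_csSup (h.bddAbove t) ⟨0, mem_Ici.2 le_rfl, by simp [h.map_zero]⟩

theorem IsYoung.exists_associate_le_half {Φ : ℝ → ℝ} (h : IsYoung Φ) :
    ∃ ε, 0 < ε ∧ associate Φ ε ≤ 1 / 2 := by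
  have hc : Tendsto Φ (nhdsWithin 0 (Ici 0)) (nhds 0) := by
    simpa [h.map_zero] using (h.continuousOn 0 (mem_Ici.2 le_rfl)).tendsto
  have hc' : ∀ᶠ a in nhdsWithin 0 (Ioi 0), Φ a < 1 / 2 :=
    (hc.mono_left (nhdsWithin_mono _ Ioi_subset_Ici_self)).eventually_lt_const (by norm_num)
  obtain ⟨a, ha, ha0⟩ := (hc'.and self_mem_nhdsWithin).exists
  have hΦa : 0 < Φ a := by
    rw [← h.map_zero]
    exact h.strictMonoOn (mem_Ici.2 le_rfl) (mem_Ici.2 (le_of_lt ha0)) ha0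
  exact ⟨Φ a / a, div_pos hΦa ha0, (h.associate_div_le ha0).trans ha.le⟩

/-- The lower limit in the B condition is immaterial, the integrand being bounded on (ε, c]. -/
theorem IsB.lintegral_lt_top {q : ℝ} (hq : 0 < q) {Φ : ℝ → ℝ} (h : IsB q Φ) (hm : Monotone Φ)
    (h0 : ∀ t, 0 ≤ Φ t) {ε : ℝ} (hε : 0 < ε) :
    ∫⁻ t in Ioi ε, ENNReal.ofReal (Φ t / t ^ (q + 1)) < ∞ := by
  obtain ⟨c, hc, hI⟩ := h
  have hsub : Ioi ε ⊆ Ioc ε c ∪ Ioi c := by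
    intro t ht
    rcases le_or_gt t c with h | h
    · exact Or.inl ⟨ht, h⟩
    · exact Or.inr h
  refine (lintegral_mono_set hsub).trans_lt ((lintegral_union_le _ _ _).trans_lt ?_)
  refine ENNReal.add_lt_top.2 ⟨?_, hI⟩
  calc ∫⁻ t in Ioc ε c, ENNReal.ofReal (Φ t / t ^ (q + 1))
      ≤ ∫⁻ t in Ioc ε c, ENNReal.ofReal (Φ c / ε ^ (q + 1)) := by
        refine setLIntegral_mono' measurableSet_Ioc fun t ht => ENNReal.ofReal_le_ofReal ?_
        have := Real.rpow_le_rpow hε.le ht.1.le (by linarith : 0 ≤ q + 1)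
        exact div_le_div₀ (h0 c) (hm ht.2) (by positivity) this
    _ < ∞ := by
        rw [setLIntegral_const]
        exact ENNReal.mul_lt_top (by finiteness) (by simp)

/-- Integrating over (T, 2T] turns the B condition into ψ̄(T) ≤ A T^q for T ≥ c, with q the dual
exponent; Young's inequality then forces ψ(a) to be at least a multiple of a^p for large a. -/
theorem exists_rpow_le_of_isB_associate {p : ℝ} (hp : 1 < p) {ψ : ℝ → ℝ} (hψ : IsYoung ψ)
    (hB : IsB (p / (p - 1)) (associate ψ)) :
    ∃ C : ℝ, 0 < C ∧ ∀ a, 0 ≤ a → a ^ p ≤ C * (1 + ψ a) := by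
  obtain ⟨c, hc, hI⟩ := hB
  have hp1 : 0 < p - 1 := by linarith
  set q := p / (p - 1) with hq
  have hq0 : 0 < q := by positivity
  set I := ∫⁻ t in Ioi c, ENNReal.ofReal (associate ψ t / t ^ (q + 1))
  set A := I.toReal * 2 ^ (q + 1) with hA
  have hA0 : 0 ≤ A := by positivity
  have hgrow : ∀ T, c ≤ T → associate ψ T ≤ A * T ^ q := by
    intro T hT
    have hT0 : 0 < T := hc.trans_le hT
    have h1 : ENNReal.ofReal (associate ψ T / (2 * T) ^ (q + 1)) * ENNReal.ofReal T ≤ I := by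
      calc ENNReal.ofReal (associate ψ T / (2 * T) ^ (q + 1)) * ENNReal.ofReal T
          = ∫⁻ t in Ioc T (2 * T), ENNReal.ofReal (associate ψ T / (2 * T) ^ (q + 1)) := by
            rw [setLIntegral_const, Real.volume_Ioc]
            congr 2
            ring
        _ ≤ ∫⁻ t in Ioc T (2 * T), ENNReal.ofReal (associate ψ t / t ^ (q + 1)) := by
            refine setLIntegral_mono' measurableSet_Ioc fun t ht => ENNReal.ofReal_le_ofReal ?_
            have ht0 : 0 < t := hT0.trans ht.1
            have := Real.rpow_le_rpow ht0.le ht.2 (by linarith : 0 ≤ q + 1)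
            exact div_le_div₀ (hψ.associate_nonneg t) (hψ.associate_mono ht.1.le)
              (by positivity) this
        _ ≤ I := lintegral_mono_set fun t ht => hT.trans_lt ht.1
    rw [← ENNReal.ofReal_mul (div_nonneg (hψ.associate_nonneg _) (by positivity)),
      ENNReal.ofReal_le_iff_le_toReal hI.ne, Real.mul_rpow (by norm_num) hT0.le,
      Real.rpow_add_one hT0.ne'] at h1
    have hTq : 0 < T ^ q := by positivity
    have h2q : (0 : ℝ) < 2 ^ (q + 1) := by positivity
    have e : associate ψ T / (2 ^ (q + 1) * (T ^ q * T)) * T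
        = associate ψ T / (2 ^ (q + 1) * T ^ q) := by field_simp
    rw [e, div_le_iff₀ (by positivity)] at h1
    rw [hA]
    linarith
  -- Young's inequality is used at b = δ a^(p-1), where b^q = δ^q a^p. This δ gives A δ^q ≤ δ/2, so
  -- half of a b = δ a^p survives; a > a₀ ensures b ≥ c.
  set δ := (1 / (2 * (A + 1))) ^ (p - 1) with hδ
  have hδ0 : 0 < δ := by positivity
  have hδq : δ ^ q = δ * (1 / (2 * (A + 1))) := by
    have e : q = 1 + 1 / (p - 1) := by rw [hq]; field_simp; ring
    rw [e, Real.rpow_add hδ0, Real.rpow_one, hδ, ← Real.rpow_mul (by positivity),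
      mul_one_div_cancel hp1.ne', Real.rpow_one]
  set a₀ := (c / δ) ^ (1 / (p - 1)) with ha₀
  have ha₀0 : 0 < a₀ := by positivity
  refine ⟨max (a₀ ^ p) (2 / δ), by positivity, fun a ha => ?_⟩
  have hψa := hψ.nonneg ha
  rcases le_or_gt a a₀ with h | h
  · calc a ^ p ≤ a₀ ^ p := Real.rpow_le_rpow ha h (by linarith)
      _ ≤ max (a₀ ^ p) (2 / δ) := le_max_left _ _
      _ ≤ max (a₀ ^ p) (2 / δ) * (1 + ψ a) :=
        le_mul_of_one_le_right (by positivity) (by linarith)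
  · have ha0 : 0 < a := ha₀0.trans h
    have hcb : c ≤ δ * a ^ (p - 1) := by
      have : a₀ ^ (p - 1) ≤ a ^ (p - 1) := Real.rpow_le_rpow ha₀0.le h.le hp1.le
      rw [ha₀, ← Real.rpow_mul (by positivity), one_div_mul_cancel hp1.ne', Real.rpow_one,
        div_le_iff₀ hδ0] at this
      linarith
    have h1 := hψ.mul_le ha (δ * a ^ (p - 1))
    have h2 := hgrow _ hcb
    have e1 : a * (δ * a ^ (p - 1)) = δ * a ^ p := by
      rw [Real.rpow_sub_one ha0.ne']; field_simp
    have e2 : (δ * a ^ (p - 1)) ^ q = δ * (1 / (2 * (A + 1))) * a ^ p := by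
      rw [Real.mul_rpow hδ0.le (by positivity), hδq, ← Real.rpow_mul ha, hq,
        mul_div_cancel₀ _ hp1.ne']
    rw [e1] at h1
    rw [e2] at h2
    have hap : 0 < a ^ p := by positivity
    have h3 : A * (δ * (1 / (2 * (A + 1))) * a ^ p) ≤ δ / 2 * a ^ p := by
      have : A * (1 / (2 * (A + 1))) ≤ 1 / 2 := by
        rw [mul_one_div, div_le_div_iff₀ (by positivity) (by norm_num)]
        linarith
      calc A * (δ * (1 / (2 * (A + 1))) * a ^ p) = A * (1 / (2 * (A + 1))) * (δ * a ^ p) := by ring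
        _ ≤ 1 / 2 * (δ * a ^ p) := by gcongr
        _ = δ / 2 * a ^ p := by ring
    have h4 : δ / 2 * a ^ p ≤ ψ a := by linarith
    calc a ^ p = 2 / δ * (δ / 2 * a ^ p) := by field_simp
      _ ≤ 2 / δ * (1 + ψ a) := by gcongr; linarith
      _ ≤ max (a₀ ^ p) (2 / δ) * (1 + ψ a) := by gcongr; exact le_max_right _ _

section Luxemburg

variable {n : ℕ} {Q : Set (Fin n → ℝ)}

theorem orliczNorm_lt_iff {Φ : ℝ → ℝ} {f : (Fin n → ℝ) → ℝ} {c : ℝ≥0∞} :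
    orliczNorm Φ Q f < c ↔ ∃ t : ℝ, 0 < t ∧
      (volume Q)⁻¹ * ∫⁻ x in Q, ENNReal.ofReal (Φ (|f x| / t)) ≤ 1 ∧ ENNReal.ofReal t < c := by
  simp only [orliczNorm, iInf_lt_iff, exists_prop]

/-- Passes from half-open grid cells to the closed cubes of the bump condition. -/
theorem orliczNorm_congr_set {R : Set (Fin n → ℝ)} (h : Q =ᵐ[volume] R) (Φ : ℝ → ℝ)
    (f : (Fin n → ℝ) → ℝ) : orliczNorm Φ Q f = orliczNorm Φ R f := by
  simp only [orliczNorm, measure_congr h, setLIntegral_congr h]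

/-- The generalized Hölder inequality for Luxemburg averages. -/
theorem IsYoung.lintegral_mul_le_orliczNorm {φ : ℝ → ℝ} (hφ : IsYoung φ)
    {w h : (Fin n → ℝ) → ℝ} (hh : AEMeasurable h volume)
    (h₁ : orliczNorm φ Q w ≠ 0 ∨ orliczNorm (associate φ) Q h ≠ ∞)
    (h₂ : orliczNorm φ Q w ≠ ∞) :
    (volume Q)⁻¹ * ∫⁻ x in Q, ENNReal.ofReal |w x| * ENNReal.ofReal |h x| ≤
      2 * (orliczNorm φ Q w * orliczNorm (associate φ) Q h) := by
  -- With the 2 moved to the left, it suffices to bound by a b for all a and b above the two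
  -- averages; `h₁` and `h₂` exclude the products 0 · ∞ for which this reduction fails.
  rw [← ENNReal.inv_mul_le_iff (by simp) (by simp)]
  refine ENNReal.le_mul_of_forall_lt h₁ (Or.inl h₂) fun a ha b hb => ?_
  rw [ENNReal.inv_mul_le_iff (by simp) (by simp)]
  obtain ⟨t, ht0, ht, hta⟩ := orliczNorm_lt_iff.1 ha
  obtain ⟨l, hl0, hl, hlb⟩ := orliczNorm_lt_iff.1 hb
  refine le_trans ?_ (mul_le_mul_right (mul_le_mul' hta.le hlb.le) 2)
  have hpt : ∀ x, ENNReal.ofReal |w x| * ENNReal.ofReal |h x| ≤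
      ENNReal.ofReal t * ENNReal.ofReal l * (ENNReal.ofReal (associate φ (|h x| / l)) +
        ENNReal.ofReal (φ (|w x| / t))) := by
    intro x
    have h1 := hφ.mul_le (a := |w x| / t) (by positivity) (|h x| / l)
    rw [← ENNReal.ofReal_add (hφ.associate_nonneg _) (hφ.nonneg (by positivity)),
      ← ENNReal.ofReal_mul (abs_nonneg (w x)), ← ENNReal.ofReal_mul ht0.le,
      ← ENNReal.ofReal_mul (by positivity)]
    refine ENNReal.ofReal_le_ofReal ?_
    calc |w x| * |h x| = t * l * (|w x| / t * (|h x| / l)) := by field_simp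
      _ ≤ t * l * (associate φ (|h x| / l) + φ (|w x| / t)) := by gcongr; linarith
  have hm : AEMeasurable (fun x => ENNReal.ofReal (associate φ (|h x| / l)))
      (volume.restrict Q) :=
    (hφ.associate_mono.measurable.comp_aemeasurable (hh.abs.div_const l)).ennreal_ofReal.restrict
  calc (volume Q)⁻¹ * ∫⁻ x in Q, ENNReal.ofReal |w x| * ENNReal.ofReal |h x|
      ≤ (volume Q)⁻¹ * ∫⁻ x in Q, ENNReal.ofReal t * ENNReal.ofReal l *
        (ENNReal.ofReal (associate φ (|h x| / l)) + ENNReal.ofReal (φ (|w x| / t))) := by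
        exact mul_le_mul_right (lintegral_mono hpt) _
    _ = ENNReal.ofReal t * ENNReal.ofReal l *
          ((volume Q)⁻¹ * (∫⁻ x in Q, ENNReal.ofReal (associate φ (|h x| / l))) +
            (volume Q)⁻¹ * ∫⁻ x in Q, ENNReal.ofReal (φ (|w x| / t))) := by
        rw [lintegral_const_mul' _ _ (by finiteness), lintegral_add_left' hm]
        ring
    _ ≤ ENNReal.ofReal t * ENNReal.ofReal l * (1 + 1) := by gcongr
    _ = 2 * (ENNReal.ofReal t * ENNReal.ofReal l) := by rw [one_add_one_eq_two, mul_comm]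

/-- Hölder against the constant 1 would give ∫_Q w = 0. Nonvanishing keeps 0 · ∞ = 0 from hiding an
infinite factor in the bump condition. -/
theorem IsYoung.orliczNorm_ne_zero {φ : ℝ → ℝ} (hφ : IsYoung φ) (hQ0 : volume Q ≠ 0)
    (hQt : volume Q ≠ ∞) {w : (Fin n → ℝ) → ℝ} (hw : AEMeasurable w volume)
    (hw0 : ∀ᵐ x, 0 < w x) : orliczNorm φ Q w ≠ 0 := by
  intro h0
  obtain ⟨ε, hε, hε1⟩ := hφ.exists_associate_le_half
  have h1 : orliczNorm (associate φ) Q (fun _ => 1) < ∞ := by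
    refine orliczNorm_lt_iff.2 ⟨1 / ε, by positivity, ?_, by finiteness⟩
    rw [setLIntegral_const, mul_comm, mul_assoc, ENNReal.mul_inv_cancel hQ0 hQt, mul_one]
    simpa using hε1.trans (by norm_num)
  have h2 := hφ.lintegral_mul_le_orliczNorm (Q := Q) (w := w) (h := fun _ => 1)
    aemeasurable_const (Or.inr h1.ne) (by simp [h0])
  rw [h0, zero_mul, mul_zero, nonpos_iff_eq_zero, mul_eq_zero] at h2
  have h3 : ∫⁻ x in Q, ENNReal.ofReal |w x| * ENNReal.ofReal |(1 : ℝ)| = 0 :=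
    h2.resolve_left (by simpa using hQt)
  simp only [abs_one, ENNReal.ofReal_one, mul_one] at h3
  rw [lintegral_eq_zero_iff' hw.abs.ennreal_ofReal.restrict] at h3
  have h4 : ∀ᵐ x ∂volume.restrict Q, False := by
    filter_upwards [h3, ae_restrict_of_ae hw0] with x hx hx0
    simp [hx0.ne'] at hx
  rw [eventually_false_iff_eq_bot, ae_eq_bot, Measure.restrict_eq_zero] at h4
  exact hQ0 h4

theorem exists_lintegral_rpow_le_orliczNorm {p : ℝ} (hp : 1 < p) {ψ : ℝ → ℝ} (hψ : IsYoung ψ)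
    (hB : IsB (p / (p - 1)) (associate ψ)) :
    ∃ C : ℝ, 0 < C ∧ ∀ {Q : Set (Fin n → ℝ)} {z : (Fin n → ℝ) → ℝ}, volume Q ≠ 0 →
      volume Q ≠ ∞ → (volume Q)⁻¹ * ∫⁻ x in Q, ENNReal.ofReal |z x| ^ p ≤
        ENNReal.ofReal C * orliczNorm ψ Q z ^ p := by
  obtain ⟨C, hC, hψC⟩ := exists_rpow_le_of_isB_associate hp hψ hB
  have hp0 : 0 < p := by linarith
  refine ⟨2 * C, by positivity, fun {Q z} hQ0 hQt => ?_⟩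
  have hC0 : ENNReal.ofReal (2 * C) ≠ 0 := by simp [hC]
  rw [← ENNReal.inv_mul_le_iff hC0 (by finiteness), ← ENNReal.rpow_inv_le_iff hp0]
  refine le_of_forall_gt fun a ha => ?_
  obtain ⟨t, ht0, ht, hta⟩ := orliczNorm_lt_iff.1 ha
  refine lt_of_le_of_lt ?_ hta
  rw [ENNReal.rpow_inv_le_iff hp0, ENNReal.inv_mul_le_iff hC0 (by finiteness)]
  have hpt : ∀ x, ENNReal.ofReal |z x| ^ p ≤
      ENNReal.ofReal t ^ p * ENNReal.ofReal C * (1 + ENNReal.ofReal (ψ (|z x| / t))) := by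
    intro x
    have h1 := hψC (|z x| / t) (by positivity)
    have h2 := hψ.nonneg (show 0 ≤ |z x| / t by positivity)
    rw [← ENNReal.ofReal_one, ← ENNReal.ofReal_add zero_le_one h2,
      ENNReal.ofReal_rpow_of_nonneg (abs_nonneg _) hp0.le,
      ENNReal.ofReal_rpow_of_nonneg ht0.le hp0.le, ← ENNReal.ofReal_mul (by positivity),
      ← ENNReal.ofReal_mul (by positivity)]
    refine ENNReal.ofReal_le_ofReal ?_
    have htp : 0 < t ^ p := by positivity
    rw [Real.div_rpow (abs_nonneg _) ht0.le, div_le_iff₀ htp] at h1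
    linarith
  calc (volume Q)⁻¹ * ∫⁻ x in Q, ENNReal.ofReal |z x| ^ p
      ≤ (volume Q)⁻¹ * ∫⁻ x in Q, ENNReal.ofReal t ^ p * ENNReal.ofReal C *
          (1 + ENNReal.ofReal (ψ (|z x| / t))) := by
        gcongr with x
        exact hpt x
    _ = ENNReal.ofReal t ^ p * ENNReal.ofReal C * (volume Q * (volume Q)⁻¹ +
          (volume Q)⁻¹ * ∫⁻ x in Q, ENNReal.ofReal (ψ (|z x| / t))) := by
        rw [lintegral_const_mul' _ _ (by finiteness), lintegral_add_left measurable_const,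
          lintegral_one, Measure.restrict_apply_univ]
        ring
    _ ≤ ENNReal.ofReal t ^ p * ENNReal.ofReal C * (1 + 1) := by
        rw [ENNReal.mul_inv_cancel hQ0 hQt]
        gcongr
    _ = ENNReal.ofReal (2 * C) * ENNReal.ofReal t ^ p := by
        rw [ENNReal.ofReal_mul (by norm_num), one_add_one_eq_two, ENNReal.ofReal_ofNat]
        ring

end Luxemburg

/-! ### The bump estimate on a single grid -/

section Bump

variable {n : ℕ}

/-- Generalized Hölder for the factorization |f|^r = v^(-r/q) · |f|^r v^(r/q). -/
theorem lintegral_rpow_le_orliczNorm {φ : ℝ → ℝ} (hφ : IsYoung φ) {q r : ℝ} (hr : 0 < r)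
    {v : (Fin n → ℝ) → ℝ} (hv : AEMeasurable v volume) (hv0 : ∀ᵐ x, 0 < v x)
    {f : (Fin n → ℝ) → ℂ} (hf : AEMeasurable f volume) {Q : Set (Fin n → ℝ)}
    (h₀ : orliczNorm φ Q (fun x => v x ^ (-(r / q))) ≠ 0)
    (h₁ : orliczNorm φ Q (fun x => v x ^ (-(r / q))) ≠ ∞) :
    (volume Q)⁻¹ * ∫⁻ x in Q, ‖f x‖ₑ ^ r ≤
      2 * (orliczNorm φ Q (fun x => v x ^ (-(r / q))) *
        orliczNorm (associate φ) Q (fun x => ‖f x‖ ^ r * v x ^ (r / q))) := by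
  have hm : AEMeasurable (fun x => ‖f x‖ ^ r * v x ^ (r / q)) volume :=
    (hf.norm.pow_const r).mul (hv.pow_const _)
  refine le_of_eq_of_le ?_ (hφ.lintegral_mul_le_orliczNorm hm (Or.inl h₀) h₁)
  congr 1
  refine lintegral_congr_ae (ae_restrict_of_ae ?_)
  filter_upwards [hv0] with x hx
  rw [← ENNReal.ofReal_mul (abs_nonneg _), ← abs_mul, mul_left_comm, ← Real.rpow_add hx,
    neg_add_cancel, Real.rpow_zero, mul_one, abs_of_nonneg (by positivity),
    ← ENNReal.ofReal_rpow_of_nonneg (norm_nonneg _) hr.le, ofReal_norm]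

theorem exists_lintegral_iSup_orliczNorm_rpow_le {φ : ℝ → ℝ} (hφ : IsYoung φ) {q r : ℝ}
    (hr : 0 < r) (hrq : r < q) (hB : IsB (q / r) (associate φ)) {v : (Fin n → ℝ) → ℝ}
    (hv : AEMeasurable v volume) (hv0 : ∀ᵐ x, 0 < v x) :
    ∃ C : ℝ≥0∞, C ≠ ∞ ∧ ∀ {π : ℕ → (Fin n → ℝ) → (Fin n → ℤ)}, IsNested volume π →
      ∀ {f : (Fin n → ℝ) → ℂ}, AEMeasurable f volume →
      ∫⁻ x, (⨆ k, orliczNorm (associate φ) (cell π k x)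
        (fun x => ‖f x‖ ^ r * v x ^ (r / q))) ^ (q / r) ≤
      C * ∫⁻ x, ‖f x‖ₑ ^ q * ENNReal.ofReal (v x) := by
  have hq : 0 < q := hr.trans hrq
  obtain ⟨ε, hε, hε1⟩ := hφ.exists_associate_le_half
  refine ⟨ENNReal.ofReal (2 * (q / r)) *
    ∫⁻ t in Ioi ε, ENNReal.ofReal (associate φ t / t ^ (q / r + 1)),
    ENNReal.mul_ne_top (by finiteness) (hB.lintegral_lt_top (by positivity)
    hφ.associate_mono hφ.associate_nonneg hε).ne, fun {π} hπ {f} hf => ?_⟩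
  have hm : AEMeasurable (fun x => ‖f x‖ ^ r * v x ^ (r / q)) volume :=
    (hf.norm.pow_const r).mul (hv.pow_const _)
  refine (hπ.lintegral_iSup_orliczNorm_rpow_le hφ.associate_mono hε hε1
    ((one_le_div hr).2 hrq.le) hm).trans_eq ?_
  congr 1
  refine lintegral_congr_ae ?_
  filter_upwards [hv0] with x hx
  rw [abs_of_nonneg (by positivity), ENNReal.ofReal_rpow_of_nonneg (by positivity)
    (by positivity), Real.mul_rpow (by positivity) (by positivity),
    ← Real.rpow_mul (norm_nonneg _), ← Real.rpow_mul hx.le, mul_div_cancel₀ _ hr.ne',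
    div_mul_div_cancel₀ hq.ne', div_self hr.ne', Real.rpow_one,
    ENNReal.ofReal_mul (by positivity), ← ENNReal.ofReal_rpow_of_nonneg (norm_nonneg _) hq.le,
    ofReal_norm]

/-- If v ≠ 0 then U ≠ 0, and since W₁, W₂ ≠ 0 the finite bound `K` forces both to be finite; so `ha`
and `hb` apply and the factors regroup, with 2^(1/r) 2^(1/s) = 2. -/
theorem bump_arith {p r s : ℝ} (hp : 0 < p) (hr : 0 < r) (hs : 0 < s)
    (hrs : 1 / r + 1 / s = 1) {a b v U W₁ W₂ N₁ N₂ K C : ℝ≥0∞}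
    (hW₁ : W₁ ≠ 0) (hW₂ : W₂ ≠ 0) (hK : K ≠ ∞) (hUW : U * W₁ ^ (1 / r) * W₂ ^ (1 / s) ≤ K)
    (hv : v ≤ C * U ^ p) (ha : W₁ ≠ ∞ → a ≤ 2 * (W₁ * N₁)) (hb : W₂ ≠ ∞ → b ≤ 2 * (W₂ * N₂)) :
    (a ^ (1 / r) * b ^ (1 / s)) ^ p * v ≤
      C * 2 ^ p * K ^ p * (N₁ ^ (1 / r) * N₂ ^ (1 / s)) ^ p := by
  have hr' : 0 < 1 / r := by positivity
  have hs' : 0 < 1 / s := by positivity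
  rcases eq_or_ne v 0 with rfl | hv0
  · simp
  have hU : U ≠ 0 := by
    rintro rfl
    rw [ENNReal.zero_rpow_of_pos hp, mul_zero, nonpos_iff_eq_zero] at hv
    exact hv0 hv
  have h₁ : W₁ ≠ ∞ := by
    rintro rfl
    rw [ENNReal.top_rpow_of_pos hr', ENNReal.mul_top hU, ENNReal.top_mul
      (by simp [ENNReal.rpow_eq_zero_iff, hW₂, hs.le]), top_le_iff] at hUW
    exact hK hUW
  have h₂ : W₂ ≠ ∞ := by
    rintro rfl
    rw [ENNReal.top_rpow_of_pos hs', ENNReal.mul_top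
      (mul_ne_zero hU (by simp [ENNReal.rpow_eq_zero_iff, hW₁, hr.le])), top_le_iff] at hUW
    exact hK hUW
  have h2 : (2 : ℝ≥0∞) ^ (1 / r) * 2 ^ (1 / s) = 2 := by
    rw [← ENNReal.rpow_add _ _ (by simp) (by simp), hrs, ENNReal.rpow_one]
  calc (a ^ (1 / r) * b ^ (1 / s)) ^ p * v
      ≤ ((2 * (W₁ * N₁)) ^ (1 / r) * (2 * (W₂ * N₂)) ^ (1 / s)) ^ p * (C * U ^ p) := by
        gcongr
        · exact ha h₁
        · exact hb h₂
    _ = C * (2 ^ (1 / r) * 2 ^ (1 / s)) ^ p * (U * W₁ ^ (1 / r) * W₂ ^ (1 / s)) ^ p *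
          (N₁ ^ (1 / r) * N₂ ^ (1 / s)) ^ p := by
        simp only [ENNReal.mul_rpow_of_nonneg _ _ hr'.le, ENNReal.mul_rpow_of_nonneg _ _ hs'.le,
          ENNReal.mul_rpow_of_nonneg _ _ hp.le]
        ring
    _ ≤ C * 2 ^ p * K ^ p * (N₁ ^ (1 / r) * N₂ ^ (1 / s)) ^ p := by
        rw [h2]
        gcongr

/-- The two-weight estimate for the maximal function over the cells of a nested grid of cubes,
with a constant which does not depend on the grid. -/
theorem exists_lintegral_partialSups_geomAvg_le
    {p p₁ p₂ r s : ℝ} (hr : 1 < r) (hrp : r < p₁) (hs : 1 < s) (hsp : s < p₂)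
    (hrs : 1 / r + 1 / s = 1) (hp : 1 / p = 1 / p₁ + 1 / p₂) (hp1 : 1 < p)
    {u v₁ v₂ : (Fin n → ℝ) → ℝ}
    (hu : AEMeasurable u volume) (hu0 : ∀ᵐ x ∂(volume : Measure (Fin n → ℝ)), 0 ≤ u x)
    (hv₁ : AEMeasurable v₁ volume) (hv₁0 : ∀ᵐ x ∂(volume : Measure (Fin n → ℝ)), 0 < v₁ x)
    (hv₂ : AEMeasurable v₂ volume) (hv₂0 : ∀ᵐ x ∂(volume : Measure (Fin n → ℝ)), 0 < v₂ x)
    {ψ φ₁ φ₂ : ℝ → ℝ} (hψ : IsYoung ψ) (hφ₁ : IsYoung φ₁) (hφ₂ : IsYoung φ₂)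
    (hψB : IsB (p / (p - 1)) (associate ψ)) (hφ₁B : IsB (p₁ / r) (associate φ₁))
    (hφ₂B : IsB (p₂ / s) (associate φ₂))
    (hbump : (⨆ (a : Fin n → ℝ) (l : ℝ) (_ : 0 < l),
      orliczNorm ψ (cube a l) (fun x => u x ^ (1 / p)) *
      orliczNorm φ₁ (cube a l) (fun x => v₁ x ^ (-(r / p₁))) ^ (1 / r) *
      orliczNorm φ₂ (cube a l) (fun x => v₂ x ^ (-(s / p₂))) ^ (1 / s)) < ∞) :
    ∃ C : ℝ≥0∞, C ≠ ∞ ∧ ∀ {π : ℕ → (Fin n → ℝ) → (Fin n → ℤ)}, IsNested volume π →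
      (∀ k x, ∃ (a : Fin n → ℝ) (l : ℝ), 0 < l ∧ cell π k x =ᵐ[volume] cube a l) →
      ∀ {f g : (Fin n → ℝ) → ℂ}, AEMeasurable f volume → AEMeasurable g volume → ∀ K : ℕ,
      ∫⁻ x, partialSups (fun k => geomAvg volume π r s (fun y => ‖f y‖ₑ ^ r)
          (fun y => ‖g y‖ₑ ^ s) k x) K ^ p * ENNReal.ofReal (u x) ≤
        C * ((∫⁻ x, ‖f x‖ₑ ^ p₁ * ENNReal.ofReal (v₁ x)) ^ (p / p₁) *
          (∫⁻ x, ‖g x‖ₑ ^ p₂ * ENNReal.ofReal (v₂ x)) ^ (p / p₂)) := by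
  have hr0 : 0 < r := by linarith
  have hs0 : 0 < s := by linarith
  have hp0 : 0 < p := by linarith
  have hp₁0 : 0 < p₁ := by linarith
  have hp₂0 : 0 < p₂ := by linarith
  obtain ⟨C₁, hC₁, hM₁⟩ := exists_lintegral_iSup_orliczNorm_rpow_le hφ₁ hr0 hrp hφ₁B hv₁ hv₁0
  obtain ⟨C₂, hC₂, hM₂⟩ := exists_lintegral_iSup_orliczNorm_rpow_le hφ₂ hs0 hsp hφ₂B hv₂ hv₂0
  obtain ⟨C₀, hC₀, hV⟩ := exists_lintegral_rpow_le_orliczNorm (n := n) hp1 hψ hψB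
  set K₀ := ⨆ (a : Fin n → ℝ) (l : ℝ) (_ : 0 < l),
      orliczNorm ψ (cube a l) (fun x => u x ^ (1 / p)) *
      orliczNorm φ₁ (cube a l) (fun x => v₁ x ^ (-(r / p₁))) ^ (1 / r) *
      orliczNorm φ₂ (cube a l) (fun x => v₂ x ^ (-(s / p₂))) ^ (1 / s) with hK₀
  set D := ENNReal.ofReal C₀ * 2 ^ p * K₀ ^ p with hD
  have hDt : D ≠ ∞ := by
    have := hbump.ne
    finiteness
  refine ⟨(ENNReal.ofReal p + 1) * (D * (C₁ ^ (p / p₁) * C₂ ^ (p / p₂))), ?_, ?_⟩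
  · finiteness
  intro π hπ hcube f g hf hg K
  have hFm : AEMeasurable (fun y => ‖f y‖ₑ ^ r) volume := hf.enorm.pow_const r
  have hGm : AEMeasurable (fun y => ‖g y‖ₑ ^ s) volume := hg.enorm.pow_const s
  have hw : ∀ {v : (Fin n → ℝ) → ℝ} (e : ℝ), (∀ᵐ x, 0 < v x) → ∀ᵐ x, 0 < v x ^ e := by
    intro v e hv
    filter_upwards [hv] with x hx
    positivity
  set N₁ : ℕ → (Fin n → ℝ) → ℝ≥0∞ := fun k x => orliczNorm (associate φ₁) (cell π k x)
    (fun x => ‖f x‖ ^ r * v₁ x ^ (r / p₁)) with hN₁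
  set N₂ : ℕ → (Fin n → ℝ) → ℝ≥0∞ := fun k x => orliczNorm (associate φ₂) (cell π k x)
    (fun x => ‖g x‖ ^ s * v₂ x ^ (s / p₂)) with hN₂
  have hN₁m : Measurable fun x => ⨆ k, N₁ k x :=
    Measurable.iSup fun k => hπ.measurable_of_factorsThrough (k := k) fun x y h => by
      simp only [hN₁, cell_eq h]
  have hN₂m : Measurable fun x => ⨆ k, N₂ k x :=
    Measurable.iSup fun k => hπ.measurable_of_factorsThrough (k := k) fun x y h => by
      simp only [hN₂, cell_eq h]
  have hcell : ∀ k x, geomAvg volume π r s (fun y => ‖f y‖ₑ ^ r) (fun y => ‖g y‖ₑ ^ s) k x ^ p *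
      cellAvg volume π k (fun x => ENNReal.ofReal (u x)) x ≤
      D * ((⨆ k, N₁ k x) ^ (1 / r) * (⨆ k, N₂ k x) ^ (1 / s)) ^ p := by
    intro k x
    have hQ0 := hπ.measure_ne_zero k x
    have hQt := hπ.measure_ne_top k x
    set Q := cell π k x with hQ
    have hW₁ : orliczNorm φ₁ Q (fun x => v₁ x ^ (-(r / p₁))) ≠ 0 :=
      hφ₁.orliczNorm_ne_zero hQ0 hQt (hv₁.pow_const _) (hw _ hv₁0)
    have hW₂ : orliczNorm φ₂ Q (fun x => v₂ x ^ (-(s / p₂))) ≠ 0 :=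
      hφ₂.orliczNorm_ne_zero hQ0 hQt (hv₂.pow_const _) (hw _ hv₂0)
    have hUW : orliczNorm ψ Q (fun x => u x ^ (1 / p)) *
        orliczNorm φ₁ Q (fun x => v₁ x ^ (-(r / p₁))) ^ (1 / r) *
        orliczNorm φ₂ Q (fun x => v₂ x ^ (-(s / p₂))) ^ (1 / s) ≤ K₀ := by
      obtain ⟨a, l, hl, hal⟩ := hcube k x
      rw [orliczNorm_congr_set hal, orliczNorm_congr_set hal, orliczNorm_congr_set hal]
      exact le_iSup_of_le a (le_iSup_of_le l (le_iSup_of_le hl le_rfl))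
    have hv : cellAvg volume π k (fun x => ENNReal.ofReal (u x)) x ≤
        ENNReal.ofReal C₀ * orliczNorm ψ Q (fun x => u x ^ (1 / p)) ^ p := by
      refine le_of_eq_of_le ?_ (hV hQ0 hQt)
      rw [cellAvg]
      congr 1
      refine lintegral_congr_ae (ae_restrict_of_ae ?_)
      filter_upwards [hu0] with y hy
      rw [abs_of_nonneg (by positivity), ENNReal.ofReal_rpow_of_nonneg (by positivity) hp0.le,
        ← Real.rpow_mul hy, one_div_mul_cancel hp0.ne', Real.rpow_one]
    refine (bump_arith hp0 hr0 hs0 hrs hW₁ hW₂ hbump.ne hUW hv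
      (lintegral_rpow_le_orliczNorm hφ₁ hr0 hv₁ hv₁0 hf hW₁)
      (lintegral_rpow_le_orliczNorm hφ₂ hs0 hv₂ hv₂0 hg hW₂)).trans ?_
    gcongr
    · exact le_iSup (fun k => N₁ k x) k
    · exact le_iSup (fun k => N₂ k x) k
  have hexp : p / p₁ + p / p₂ = 1 := by
    rw [div_eq_mul_one_div p p₁, div_eq_mul_one_div p p₂, ← mul_add, ← hp,
      mul_one_div_cancel hp0.ne']
  -- Hölder with weights p/p₁ and p/p₂, using p/r = (p₁/r)(p/p₁) and p/s = (p₂/s)(p/p₂).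
  have hH : ∫⁻ x, ((⨆ k, N₁ k x) ^ (1 / r) * (⨆ k, N₂ k x) ^ (1 / s)) ^ p ≤
      (∫⁻ x, (⨆ k, N₁ k x) ^ (p₁ / r)) ^ (p / p₁) *
        (∫⁻ x, (⨆ k, N₂ k x) ^ (p₂ / s)) ^ (p / p₂) := by
    refine le_of_eq_of_le ?_ (ENNReal.lintegral_mul_norm_pow_le (hN₁m.pow_const _).aemeasurable
      (hN₂m.pow_const _).aemeasurable (by positivity) (by positivity) hexp)
    refine lintegral_congr fun x => ?_
    rw [ENNReal.mul_rpow_of_nonneg _ _ hp0.le, ← ENNReal.rpow_mul, ← ENNReal.rpow_mul,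
      ← ENNReal.rpow_mul, ← ENNReal.rpow_mul]
    congr 2 <;> field_simp
  calc ∫⁻ x, partialSups (fun k => geomAvg volume π r s (fun y => ‖f y‖ₑ ^ r)
          (fun y => ‖g y‖ₑ ^ s) k x) K ^ p * ENNReal.ofReal (u x)
      ≤ (ENNReal.ofReal p + 1) * ∫⁻ x, partialSups (fun k => geomAvg volume π r s
          (fun y => ‖f y‖ₑ ^ r) (fun y => ‖g y‖ₑ ^ s) k x ^ p *
            cellAvg volume π k (fun x => ENNReal.ofReal (u x)) x) K :=
        hπ.lintegral_partialSups_rpow_mul_le hp1.le hr0 hs0 hrs hFm hGm hu.ennreal_ofReal K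
    _ ≤ (ENNReal.ofReal p + 1) *
          ∫⁻ x, D * ((⨆ k, N₁ k x) ^ (1 / r) * (⨆ k, N₂ k x) ^ (1 / s)) ^ p := by
        gcongr with x
        exact partialSups_le _ _ _ fun k _ => hcell k x
    _ = (ENNReal.ofReal p + 1) *
          (D * ∫⁻ x, ((⨆ k, N₁ k x) ^ (1 / r) * (⨆ k, N₂ k x) ^ (1 / s)) ^ p) := by
        rw [lintegral_const_mul' _ _ hDt]
    _ ≤ (ENNReal.ofReal p + 1) * (D *
          ((C₁ * ∫⁻ x, ‖f x‖ₑ ^ p₁ * ENNReal.ofReal (v₁ x)) ^ (p / p₁) *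
          (C₂ * ∫⁻ x, ‖g x‖ₑ ^ p₂ * ENNReal.ofReal (v₂ x)) ^ (p / p₂))) := by
        gcongr
        refine hH.trans ?_
        gcongr
        · exact hM₁ hπ hf
        · exact hM₂ hπ hg
    _ = _ := by
        rw [ENNReal.mul_rpow_of_nonneg _ _ (by positivity),
          ENNReal.mul_rpow_of_nonneg _ _ (by positivity)]
        ring

end Bump

/-! ### Shifted dyadic grids -/

section Grid

variable {n : ℕ}

/-- The shift, relative to the side length `2 ^ j`, of the adjacent dyadic grids. -/
noncomputable def gridShift (b : Bool) (j : ℤ) : ℝ := if b then (-1) ^ j / 3 else 0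

/-- The index of the cube of side length `2 ^ j` containing `x`, in the grid given by `α`. -/
noncomputable def dyadicIndex (α : Fin n → Bool) (j : ℤ) (x : Fin n → ℝ) : Fin n → ℤ :=
  fun i => ⌊x i / 2 ^ j - gridShift (α i) j⌋

/-- The alternating sign keeps the shifted grids nested: (1/3 - 1)/2 = -1/3 and (-1/3 + 1)/2 = 1/3.
-/
theorem exists_gridShift_succ (b : Bool) (j : ℤ) :
    ∃ m : ℤ, gridShift b (j + 1) = (gridShift b j - m) / 2 := by
  cases b
  · exact ⟨0, by simp [gridShift]⟩
  · rcases Int.even_or_odd j with h | h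
    · refine ⟨1, ?_⟩
      simp only [gridShift, if_true, h.neg_one_zpow, h.add_one.neg_one_zpow]
      norm_num
    · refine ⟨-1, ?_⟩
      simp only [gridShift, if_true, h.neg_one_zpow, h.add_one.neg_one_zpow]
      norm_num

/-- In each coordinate the coarse index is ⌊(z + m)/2⌋ with `m` an integer, which depends only on
⌊z⌋. -/
theorem dyadicIndex_succ (α : Fin n → Bool) (j : ℤ) :
    (dyadicIndex α (j + 1)).FactorsThrough (dyadicIndex α j) := by
  intro x y h
  ext i
  obtain ⟨m, hm⟩ := exists_gridShift_succ (α i) j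
  have hi := congrFun h i
  simp only [dyadicIndex] at hi ⊢
  have key : ∀ z : ℝ, z / 2 ^ (j + 1) - gridShift (α i) (j + 1) =
      ((z / 2 ^ j - gridShift (α i) j) + m) / (2 : ℕ) := by
    intro z
    rw [hm, zpow_add_one₀ (by norm_num)]
    push_cast
    field_simp
    ring
  rw [key, key, Int.floor_div_natCast, Int.floor_div_natCast, Int.floor_add_intCast,
    Int.floor_add_intCast, hi]

theorem measurable_dyadicIndex (α : Fin n → Bool) (j : ℤ) : Measurable (dyadicIndex α j) := by
  refine measurable_pi_lambda _ fun i => Int.measurable_floor.comp ?_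
  fun_prop

theorem dyadicIndex_preimage_eq (α : Fin n → Bool) (j : ℤ) (m : Fin n → ℤ) :
    dyadicIndex α j ⁻¹' {m} = univ.pi fun i => Ico (2 ^ j * (m i + gridShift (α i) j))
      (2 ^ j * (m i + gridShift (α i) j) + 2 ^ j) := by
  have h2 : (0 : ℝ) < 2 ^ j := by positivity
  ext x
  simp only [mem_preimage, mem_singleton_iff, funext_iff, dyadicIndex, Int.floor_eq_iff,
    mem_univ_pi, mem_Ico]
  refine forall_congr' fun i => and_congr ?_ ?_
  · rw [le_sub_iff_add_le, le_div_iff₀ h2, mul_comm]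
  · rw [sub_lt_iff_lt_add, div_lt_iff₀ h2]
    constructor <;> intro h <;> linarith

/-- The dyadic grid given by `α`, from the scale `2 ^ N` downwards. -/
noncomputable def dyadicGrid (α : Fin n → Bool) (N : ℕ) (k : ℕ) : (Fin n → ℝ) → Fin n → ℤ :=
  dyadicIndex α (N - k)

theorem cell_dyadicGrid_ae_eq (α : Fin n → Bool) (N k : ℕ) (x : Fin n → ℝ) :
    ∃ a : Fin n → ℝ, cell (dyadicGrid α N) k x =ᵐ[volume] cube a (2 ^ ((N : ℤ) - k)) := by
  refine ⟨fun i => 2 ^ ((N : ℤ) - k) *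
    (dyadicIndex α (N - k) x i + gridShift (α i) (N - k)), ?_⟩
  rw [cell, dyadicGrid, dyadicIndex_preimage_eq, cube]
  exact Measure.univ_pi_Ico_ae_eq_Icc

theorem volume_cube (a : Fin n → ℝ) (l : ℝ) : volume (cube a l) = ENNReal.ofReal l ^ n := by
  rw [cube, Real.volume_Icc_pi]
  simp

theorem volume_cell_dyadicGrid (α : Fin n → Bool) (N k : ℕ) (x : Fin n → ℝ) :
    volume (cell (dyadicGrid α N) k x) = ENNReal.ofReal (2 ^ ((N : ℤ) - k)) ^ n := by
  obtain ⟨a, ha⟩ := cell_dyadicGrid_ae_eq α N k x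
  rw [measure_congr ha, volume_cube]

theorem isNested_dyadicGrid (α : Fin n → Bool) (N : ℕ) :
    IsNested volume (dyadicGrid α N) where
  measurable k := measurable_dyadicIndex _ _
  refines k := by
    have := dyadicIndex_succ α (N - (k + 1 : ℕ))
    have e : (N : ℤ) - (k + 1 : ℕ) + 1 = N - k := by push_cast; ring
    rwa [e] at this
  measure_ne_zero k x := by
    rw [volume_cell_dyadicGrid]
    have : (0 : ℝ) < 2 ^ ((N : ℤ) - k) := by positivity
    positivity
  measure_ne_top k x := by
    rw [volume_cell_dyadicGrid]
    finiteness

/-- An interval which is short compared to the scale is contained in an interval of the dyadic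
grid or of the shifted one. -/
theorem exists_floor_eq {j : ℤ} {x t : ℝ} (ht : 6 * t < 2 ^ j) :
    ∃ b : Bool, ∀ y ∈ Icc (x - t) (x + t),
      ⌊y / 2 ^ j - gridShift b j⌋ = ⌊x / 2 ^ j - gridShift b j⌋ := by
  have h2 : (0 : ℝ) < 2 ^ j := by positivity
  by_contra! hcon
  -- If both grids fail, each has an endpoint within 1/6 of x, in units of 2^j. The two endpoints
  -- are then less than 1/3 apart, which the relative shift ±1/3 forbids.
  have key : ∀ b, ∃ m : ℤ, |m + gridShift b j - x / 2 ^ j| < 1 / 6 := by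
    intro b
    obtain ⟨y, hy, hne⟩ := hcon b
    set σ := gridShift b j
    have hyx : |y / 2 ^ j - x / 2 ^ j| < 1 / 6 := by
      rw [← sub_div, abs_div, abs_of_pos h2, div_lt_iff₀ h2]
      have : |y - x| ≤ t := abs_le.2 ⟨by linarith [hy.1], by linarith [hy.2]⟩
      linarith
    rw [abs_lt] at hyx
    rcases lt_or_gt_of_ne hne with h | h
    · refine ⟨⌊x / 2 ^ j - σ⌋, ?_⟩
      have e1 := Int.floor_le (x / 2 ^ j - σ)
      have e2 := Int.floor_lt.1 h
      rw [abs_lt]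
      constructor <;> linarith
    · refine ⟨⌊y / 2 ^ j - σ⌋, ?_⟩
      have e1 := Int.floor_le (y / 2 ^ j - σ)
      have e2 := Int.floor_lt.1 h
      rw [abs_lt]
      constructor <;> linarith
  obtain ⟨a, ha⟩ := key false
  obtain ⟨b, hb⟩ := key true
  have hsh : gridShift true j = 1 / 3 ∨ gridShift true j = -1 / 3 := by
    rcases Int.even_or_odd j with h | h
    · left; simp [gridShift, h.neg_one_zpow]
    · right; simp [gridShift, h.neg_one_zpow]
  have h0 : gridShift false j = 0 := by simp [gridShift]
  rw [abs_lt] at ha hb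
  rw [h0] at ha
  -- The multiple 3(b - a) of 3 would lie strictly between -2 and 0, or strictly between 0 and 2.
  have h1 : (3 * (b - a) : ℝ) < 1 - 3 * gridShift true j := by linarith [ha.1, hb.2]
  have h2' : -1 - 3 * gridShift true j < (3 * (b - a) : ℝ) := by linarith [ha.2, hb.1]
  rcases hsh with h | h
  · rw [h] at h1 h2'
    have e1 : 3 * (b - a) < (0 : ℤ) := by
      have : (3 * (b - a) : ℝ) < 0 := by linarith
      exact_mod_cast this
    have e2 : (-2 : ℤ) < 3 * (b - a) := by
      have : (-2 : ℝ) < 3 * (b - a) := by linarith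
      exact_mod_cast this
    omega
  · rw [h] at h1 h2'
    have e1 : 3 * (b - a) < (2 : ℤ) := by
      have : (3 * (b - a) : ℝ) < 2 := by linarith
      exact_mod_cast this
    have e2 : (0 : ℤ) < 3 * (b - a) := by
      have : (0 : ℝ) < 3 * (b - a) := by linarith
      exact_mod_cast this
    omega

theorem exists_Icc_subset_dyadicIndex {j : ℤ} {t : ℝ} (ht : 6 * t < 2 ^ j) (x : Fin n → ℝ) :
    ∃ α : Fin n → Bool, Icc (fun i => x i - t) (fun i => x i + t) ⊆
      dyadicIndex α j ⁻¹' {dyadicIndex α j x} := by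
  choose α hα using fun i => exists_floor_eq (x := x i) ht
  refine ⟨α, fun y hy => funext fun i => hα i (y i) ⟨hy.1 i, hy.2 i⟩⟩

/-! ### The bilinear maximal function -/

theorem setLIntegral_comp_sub (a : (Fin n → ℝ) → ℝ≥0∞) (x : Fin n → ℝ) (t : ℝ) :
    ∫⁻ y in Icc (fun _ : Fin n => -t) (fun _ => t), a (x - y) =
      ∫⁻ y in Icc (fun i => x i - t) (fun i => x i + t), a y := by
  rw [← lintegral_indicator measurableSet_Icc, ← lintegral_indicator measurableSet_Icc,
    ← lintegral_sub_left_eq_self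
      ((Icc (fun i => x i - t) (fun i => x i + t)).indicator a) x]
  congr 1 with y
  have : x - y ∈ Icc (fun i => x i - t) (fun i => x i + t) ↔
      y ∈ Icc (fun _ : Fin n => -t) (fun _ => t) := by
    simp only [mem_Icc, Pi.le_def, Pi.sub_apply]
    constructor <;> rintro ⟨h1, h2⟩ <;>
      exact ⟨fun i => by linarith [h1 i, h2 i], fun i => by linarith [h1 i, h2 i]⟩
  by_cases hy : y ∈ Icc (fun _ : Fin n => -t) (fun _ => t)
  · rw [indicator_of_mem hy, indicator_of_mem (this.2 hy)]
  · rw [indicator_of_notMem hy, indicator_of_notMem (fun h => hy (this.1 h))]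

theorem setLIntegral_comp_add (a : (Fin n → ℝ) → ℝ≥0∞) (x : Fin n → ℝ) (t : ℝ) :
    ∫⁻ y in Icc (fun _ : Fin n => -t) (fun _ => t), a (x + y) =
      ∫⁻ y in Icc (fun i => x i - t) (fun i => x i + t), a y := by
  rw [← lintegral_indicator measurableSet_Icc, ← lintegral_indicator measurableSet_Icc,
    ← lintegral_add_left_eq_self
      ((Icc (fun i => x i - t) (fun i => x i + t)).indicator a) x]
  congr 1 with y
  have : x + y ∈ Icc (fun i => x i - t) (fun i => x i + t) ↔
      y ∈ Icc (fun _ : Fin n => -t) (fun _ => t) := by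
    simp only [mem_Icc, Pi.le_def, Pi.add_apply]
    constructor <;> rintro ⟨h1, h2⟩ <;>
      exact ⟨fun i => by linarith [h1 i, h2 i], fun i => by linarith [h1 i, h2 i]⟩
  by_cases hy : y ∈ Icc (fun _ : Fin n => -t) (fun _ => t)
  · rw [indicator_of_mem hy, indicator_of_mem (this.2 hy)]
  · rw [indicator_of_notMem hy, indicator_of_notMem (fun h => hy (this.1 h))]

/-- Hölder; as [-t,t]^n is symmetric, x - y and x + y sweep the same cube around x. -/
theorem BM_average_le {r s : ℝ} (hr : 0 < r) (hs : 0 < s) (hrs : 1 / r + 1 / s = 1)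
    {f g : (Fin n → ℝ) → ℂ} (hf : AEMeasurable f volume) (hg : AEMeasurable g volume)
    (x : Fin n → ℝ) (t : ℝ) :
    ∫⁻ y in Icc (fun _ : Fin n => -t) (fun _ => t), ‖f (x - y) * g (x + y)‖ₑ ≤
      (∫⁻ y in Icc (fun i => x i - t) (fun i => x i + t), ‖f y‖ₑ ^ r) ^ (1 / r) *
      (∫⁻ y in Icc (fun i => x i - t) (fun i => x i + t), ‖g y‖ₑ ^ s) ^ (1 / s) := by
  rw [← setLIntegral_comp_sub, ← setLIntegral_comp_add]
  have hf' : AEMeasurable (fun y => ‖f (x - y)‖ₑ ^ r) volume :=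
    (hf.comp_quasiMeasurePreserving
      (Measure.measurePreserving_sub_left volume x).quasiMeasurePreserving).enorm.pow_const r
  have hg' : AEMeasurable (fun y => ‖g (x + y)‖ₑ ^ s) volume :=
    (hg.comp_quasiMeasurePreserving
      (measurePreserving_add_left volume x).quasiMeasurePreserving).enorm.pow_const s
  refine le_of_eq_of_le ?_ (ENNReal.lintegral_mul_norm_pow_le hf'.restrict hg'.restrict
    (by positivity) (by positivity) hrs)
  refine lintegral_congr fun y => ?_
  rw [enorm_mul, ← ENNReal.rpow_mul, ← ENNReal.rpow_mul, mul_one_div_cancel hr.ne',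
    mul_one_div_cancel hs.ne', ENNReal.rpow_one, ENNReal.rpow_one]

/-- The bilinear maximal function is controlled by finitely many dyadic ones. -/
theorem BM_le_iSup_geomAvg {r s : ℝ} (hr : 0 < r) (hs : 0 < s) (hrs : 1 / r + 1 / s = 1)
    {f g : (Fin n → ℝ) → ℂ} (hf : AEMeasurable f volume) (hg : AEMeasurable g volume)
    (x : Fin n → ℝ) :
    BM f g x ≤ 6 ^ n * ⨆ (α : Fin n → Bool) (N : ℕ), partialSups (fun k => geomAvg volume
      (dyadicGrid α N) r s (fun y => ‖f y‖ₑ ^ r) (fun y => ‖g y‖ₑ ^ s) k x) (2 * N) := by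
  have hr' : 0 < 1 / r := by positivity
  have hs' : 0 < 1 / s := by positivity
  refine iSup₂_le fun t ht => ?_
  -- Then 6t < 2^j ≤ 6 · 2t: the cell is large enough to contain the cube, and the volume ratio is
  -- at most 6^n.
  obtain ⟨j, hj1, hj2⟩ := exists_mem_Ico_zpow (show 0 < 12 * t by positivity) one_lt_two
  rw [zpow_add_one₀ (by norm_num)] at hj2
  have h6 : 6 * t < 2 ^ j := by linarith
  obtain ⟨α, hα⟩ := exists_Icc_subset_dyadicIndex h6 x
  -- Scale 2^j occurs at level k = N - j, and N = |j| gives k ≤ 2N, the range of the partial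
  -- supremum.
  set N := j.natAbs with hN
  set k := (N - j).toNat with hk
  have hkj : (N : ℤ) - k = j := by omega
  have hkN : k ≤ 2 * N := by omega
  set Q := Icc (fun i => x i - t) (fun i => x i + t) with hQ
  have hsub : Q ⊆ cell (dyadicGrid α N) k x := by rw [cell, dyadicGrid, hkj]; exact hα
  have hnest := isNested_dyadicGrid α N
  have hvol : volume (cell (dyadicGrid α N) k x) ≤ 6 ^ n * ENNReal.ofReal (2 * t) ^ n := by
    rw [volume_cell_dyadicGrid, hkj, ← mul_pow]
    gcongr
    rw [← ENNReal.ofReal_ofNat 6, ← ENNReal.ofReal_mul (by norm_num)]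
    exact ENNReal.ofReal_le_ofReal (by linarith)
  have hinv : ENNReal.ofReal (1 / (2 * t) ^ n) * ENNReal.ofReal (2 * t) ^ n = 1 := by
    rw [← ENNReal.ofReal_pow (by positivity), ← ENNReal.ofReal_mul (by positivity),
      one_div_mul_cancel (by positivity), ENNReal.ofReal_one]
  set F := fun y => ‖f y‖ₑ ^ r with hF
  set G := fun y => ‖g y‖ₑ ^ s with hG
  have hB : (∫⁻ y in Q, F y) ^ (1 / r) * (∫⁻ y in Q, G y) ^ (1 / s) ≤
      volume (cell (dyadicGrid α N) k x) * geomAvg volume (dyadicGrid α N) r s F G k x := by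
    calc (∫⁻ y in Q, F y) ^ (1 / r) * (∫⁻ y in Q, G y) ^ (1 / s)
        ≤ (∫⁻ y in cell (dyadicGrid α N) k x, F y) ^ (1 / r) *
            (∫⁻ y in cell (dyadicGrid α N) k x, G y) ^ (1 / s) := by
          gcongr
      _ = _ := by
          rw [← hnest.mul_cellAvg, ← hnest.mul_cellAvg, ENNReal.mul_rpow_of_nonneg _ _ hr'.le,
            ENNReal.mul_rpow_of_nonneg _ _ hs'.le, mul_mul_mul_comm,
            ← ENNReal.rpow_add_of_nonneg _ _ hr'.le hs'.le, hrs, ENNReal.rpow_one, geomAvg]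
  calc ENNReal.ofReal (1 / (2 * t) ^ n) *
        ∫⁻ y in Icc (fun _ : Fin n => -t) (fun _ => t), ‖f (x - y) * g (x + y)‖ₑ
      ≤ ENNReal.ofReal (1 / (2 * t) ^ n) * ((6 ^ n * ENNReal.ofReal (2 * t) ^ n) *
          geomAvg volume (dyadicGrid α N) r s F G k x) := by
        gcongr
        exact ((BM_average_le hr hs hrs hf hg x t).trans hB).trans (by gcongr)
    _ = (ENNReal.ofReal (1 / (2 * t) ^ n) * ENNReal.ofReal (2 * t) ^ n) * (6 ^ n *
          geomAvg volume (dyadicGrid α N) r s F G k x) := by ring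
    _ = 6 ^ n * geomAvg volume (dyadicGrid α N) r s F G k x := by rw [hinv, one_mul]
    _ ≤ _ := by
        gcongr
        exact (le_partialSups_of_le (fun k => geomAvg volume (dyadicGrid α N) r s F G k x)
          hkN).trans (le_iSup₂_of_le α N le_rfl)

/-- For fixed x, y ↦ x - y and y ↦ x + y preserve Lebesgue measure, so equality holds at every x. -/
theorem BM_congr_ae {f g f' g' : (Fin n → ℝ) → ℂ} (hf : f =ᵐ[volume] f')
    (hg : g =ᵐ[volume] g') : BM f g = BM f' g' := by
  ext x
  simp only [BM]
  congr 1 with t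
  congr 1 with _
  congr 1
  refine lintegral_congr_ae (ae_restrict_of_ae ?_)
  filter_upwards [(Measure.measurePreserving_sub_left volume x).quasiMeasurePreserving.ae_eq hf,
    (measurePreserving_add_left volume x).quasiMeasurePreserving.ae_eq hg] with y h1 h2
  simp only [Function.comp_apply] at h1 h2
  rw [h1, h2]

/-- Makes the supremum countable, for measurability. Rational cubes increasing to [-t,t]^n exhaust
its interior, of full measure in it, and their prefactors are larger. -/
theorem BM_eq_iSup_rat (f g : (Fin n → ℝ) → ℂ) (x : Fin n → ℝ) :
    BM f g x = ⨆ (t : ℚ) (_ : 0 < t), ENNReal.ofReal (1 / (2 * (t : ℝ)) ^ n) *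
      ∫⁻ y in Icc (fun _ : Fin n => -(t : ℝ)) (fun _ => (t : ℝ)), ‖f (x - y) * g (x + y)‖ₑ := by
  refine le_antisymm (iSup₂_le fun t ht => ?_) (iSup₂_le fun t ht =>
    le_iSup₂_of_le (t : ℝ) (by exact_mod_cast ht) le_rfl)
  set a := fun y => ‖f (x - y) * g (x + y)‖ₑ
  obtain ⟨v, hvm, hvI, hvt⟩ := Rat.denseRange_cast (𝕜 := ℝ).exists_seq_strictMono_tendsto_of_lt
    Rat.cast_mono ht
  set S : ℕ → Set (Fin n → ℝ) := fun k => Icc (fun _ => -(v k : ℝ)) (fun _ => (v k : ℝ)) with hS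
  have hSm : Monotone S := by
    intro i j hij
    have h : (v i : ℝ) ≤ v j := by exact_mod_cast hvm.monotone hij
    exact Icc_subset_Icc (fun _ => neg_le_neg h) (fun _ => h)
  have hU : ∫⁻ y in Icc (fun _ : Fin n => -t) (fun _ => t), a y = ∫⁻ y in ⋃ k, S k, a y := by
    have h1 : (univ.pi fun _ : Fin n => Ioo (-t) t) =ᵐ[volume]
        Icc (fun _ : Fin n => -t) (fun _ => t) := Measure.univ_pi_Ioo_ae_eq_Icc
    rw [← setLIntegral_congr h1]
    congr 2
    ext y
    simp only [mem_univ_pi, mem_Ioo, mem_iUnion, hS, mem_Icc, Pi.le_def]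
    constructor
    · intro hy
      have : ∀ i, ∀ᶠ k in atTop, |y i| < v k := fun i =>
        hvt.eventually_const_lt (abs_lt.2 (hy i))
      obtain ⟨k, hk⟩ := (eventually_all.2 this).exists
      exact ⟨k, fun i => (abs_lt.1 (hk i)).1.le, fun i => (abs_lt.1 (hk i)).2.le⟩
    · rintro ⟨k, h1, h2⟩ i
      have := (hvI k).2
      exact ⟨by linarith [h1 i], by linarith [h2 i]⟩
  have hlim : ∫⁻ y in ⋃ k, S k, a y = ⨆ k, ∫⁻ y in S k, a y :=
    setLIntegral_iUnion_of_directed _ hSm.directed_le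
  rw [hU, hlim, ENNReal.mul_iSup]
  refine iSup_le fun k => ?_
  have hk0 : (0 : ℝ) < v k := (hvI k).1
  refine le_iSup₂_of_le (v k) (by exact_mod_cast hk0) ?_
  gcongr
  exact (hvI k).2.le

theorem measurable_BM {f g : (Fin n → ℝ) → ℂ} (hf : Measurable f) (hg : Measurable g) :
    Measurable (BM f g) := by
  have : BM f g = fun x => _ := funext (BM_eq_iSup_rat f g)
  rw [this]
  refine Measurable.iSup fun t => Measurable.iSup fun _ => Measurable.const_mul ?_ _
  refine Measurable.lintegral_prod_right' (f := fun z : (Fin n → ℝ) × (Fin n → ℝ) =>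
    ‖f (z.1 - z.2) * g (z.1 + z.2)‖ₑ) ?_
  fun_prop

theorem aemeasurable_BM {f g : (Fin n → ℝ) → ℂ} (hf : AEMeasurable f volume)
    (hg : AEMeasurable g volume) : AEMeasurable (BM f g) volume := by
  rw [BM_congr_ae hf.ae_eq_mk hg.ae_eq_mk]
  exact (measurable_BM hf.measurable_mk hg.measurable_mk).aemeasurable

end Grid

/-! ### Passage to the limit over the grids, and weighted norms -/

theorem partialSups_geomAvg_dyadicGrid_mono {n : ℕ} (α : Fin n → Bool) (r s : ℝ)
    (F G : (Fin n → ℝ) → ℝ≥0∞) (x : Fin n → ℝ) :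
    Monotone fun N : ℕ =>
      partialSups (fun k => geomAvg volume (dyadicGrid α N) r s F G k x) (2 * N) := by
  intro N M hNM
  refine partialSups_le _ _ _ fun k hk => ?_
  have e : dyadicGrid α N k = dyadicGrid α M (k + (M - N)) := by
    rw [dyadicGrid, dyadicGrid]
    congr 1
    omega
  have : geomAvg volume (dyadicGrid α N) r s F G k x =
      geomAvg volume (dyadicGrid α M) r s F G (k + (M - N)) x := by
    simp only [geomAvg, cellAvg, cell, e]
  rw [this]
  exact le_partialSups_of_le (fun k => geomAvg volume (dyadicGrid α M) r s F G k x) (by omega)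

theorem iSup_rpow_mul {κ : Sort*} {p : ℝ} (hp : 0 < p) (a : κ → ℝ≥0∞) (c : ℝ≥0∞) :
    (⨆ i, a i) ^ p * c = ⨆ i, a i ^ p * c := by
  rw [← ENNReal.iSup_mul]
  congr 1
  exact (ENNReal.orderIsoRpow p hp).map_iSup a

/-- The supremum over the 2^n grids is at most the sum; the one over the top scale `N` is
increasing, so monotone convergence applies. -/
theorem lintegral_BM_rpow_le {n : ℕ} {p r s : ℝ} (hp : 0 < p) (hr : 0 < r) (hs : 0 < s)
    (hrs : 1 / r + 1 / s = 1) {f g : (Fin n → ℝ) → ℂ} (hf : AEMeasurable f volume)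
    (hg : AEMeasurable g volume) {w : (Fin n → ℝ) → ℝ≥0∞} (hw : AEMeasurable w volume)
    {A : ℝ≥0∞} (hA : ∀ (α : Fin n → Bool) (N K : ℕ), ∫⁻ x, partialSups (fun k => geomAvg volume
      (dyadicGrid α N) r s (fun y => ‖f y‖ₑ ^ r) (fun y => ‖g y‖ₑ ^ s) k x) K ^ p * w x ≤ A) :
    ∫⁻ x, BM f g x ^ p * w x ≤ (6 ^ n) ^ p * (2 ^ n * A) := by
  set P : (Fin n → Bool) → ℕ → (Fin n → ℝ) → ℝ≥0∞ := fun α N x =>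
    partialSups (fun k => geomAvg volume (dyadicGrid α N) r s (fun y => ‖f y‖ₑ ^ r)
      (fun y => ‖g y‖ₑ ^ s) k x) (2 * N) with hP
  have hPm : ∀ α N, Measurable (P α N) := fun α N =>
    (isNested_dyadicGrid α N).measurable_of_factorsThrough
      ((isNested_dyadicGrid α N).factorsThrough_partialSups
        (fun k => geomAvg_factorsThrough r s _ _ k) (2 * N))
  calc ∫⁻ x, BM f g x ^ p * w x
      ≤ ∫⁻ x, (6 ^ n) ^ p * ∑ α, (⨆ N, P α N x) ^ p * w x := by
        refine lintegral_mono fun x => ?_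
        calc BM f g x ^ p * w x ≤ (6 ^ n * ⨆ α, ⨆ N, P α N x) ^ p * w x := by
              gcongr
              exact BM_le_iSup_geomAvg hr hs hrs hf hg x
          _ = (6 ^ n) ^ p * ⨆ α, (⨆ N, P α N x) ^ p * w x := by
              rw [ENNReal.mul_rpow_of_nonneg _ _ hp.le, mul_assoc, iSup_rpow_mul hp]
          _ ≤ _ := by
              gcongr
              exact iSup_le fun α => Finset.single_le_sum
                (f := fun α => (⨆ N, P α N x) ^ p * w x) (fun _ _ => zero_le) (Finset.mem_univ α)
    _ = (6 ^ n) ^ p * ∑ α, ∫⁻ x, ⨆ N, P α N x ^ p * w x := by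
        rw [lintegral_const_mul' _ _ (by finiteness), lintegral_finsetSum']
        · simp only [iSup_rpow_mul hp]
        · intro α _
          exact ((Measurable.iSup (hPm α)).pow_const p).aemeasurable.mul hw
    _ ≤ (6 ^ n) ^ p * ∑ α : Fin n → Bool, A := by
        gcongr with α
        rw [lintegral_iSup' (f := fun N x => P α N x ^ p * w x)
          (fun N => ((hPm α N).pow_const p).aemeasurable.mul hw)
          (ae_of_all _ fun x N M hNM => ?_)]
        · exact iSup_le fun N => hA α N (2 * N)
        · beta_reduce
          gcongr
          exact partialSups_geomAvg_dyadicGrid_mono α r s _ _ x hNM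
    _ = (6 ^ n) ^ p * (2 ^ n * A) := by simp

theorem eLpNorm_weighted {n : ℕ} {E : Type*} [TopologicalSpace E] [ContinuousENorm E]
    {p : ℝ} (hp : 0 < p) {w : (Fin n → ℝ) → ℝ} (hw : AEMeasurable w volume)
    {h : (Fin n → ℝ) → E} (hh : AEMeasurable (fun x => ‖h x‖ₑ) volume) :
    eLpNorm h (ENNReal.ofReal p) (weighted w) =
      (∫⁻ x, ‖h x‖ₑ ^ p * ENNReal.ofReal (w x)) ^ (1 / p) := by
  rw [eLpNorm_eq_lintegral_rpow_enorm_toReal (by simpa using hp) (by simp),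
    ENNReal.toReal_ofReal hp.le, weighted,
    lintegral_withDensity_eq_lintegral_mul₀ hw.ennreal_ofReal (hh.pow_const p)]
  simp only [Pi.mul_apply, mul_comm]

/-- As v > 0 almost everywhere, Lebesgue measure is absolutely continuous with respect to v dx. -/
theorem aemeasurable_of_memLp_weighted {n : ℕ} {v : (Fin n → ℝ) → ℝ} (hv : AEMeasurable v volume)
    (hv0 : ∀ᵐ x, 0 < v x) {q : ℝ≥0∞} {f : (Fin n → ℝ) → ℂ} (hf : MemLp f q (weighted v)) :
    AEMeasurable f volume := by
  refine hf.aestronglyMeasurable.aemeasurable.mono_ac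
    (withDensity_absolutelyContinuous' hv.ennreal_ofReal ?_)
  filter_upwards [hv0] with x hx
  simpa using hx

end BilinearMaximal

theorem mainTheorem10 {n : ℕ} (hn : 1 ≤ n)
    (p p₁ p₂ r s : ℝ) (hr : 1 < r) (hrp : r < p₁) (hs : 1 < s) (hsp : s < p₂)
    (hrs : 1 / r + 1 / s = 1) (hp : 1 / p = 1 / p₁ + 1 / p₂) (hp1 : 1 < p)
    (u v₁ v₂ : (Fin n → ℝ) → ℝ)
    (hu : AEMeasurable u volume) (hu0 : ∀ᵐ x ∂(volume : Measure (Fin n → ℝ)), 0 ≤ u x)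
    (hv₁ : AEMeasurable v₁ volume) (hv₁0 : ∀ᵐ x ∂(volume : Measure (Fin n → ℝ)), 0 < v₁ x)
    (hv₂ : AEMeasurable v₂ volume) (hv₂0 : ∀ᵐ x ∂(volume : Measure (Fin n → ℝ)), 0 < v₂ x)
    (ψ φ₁ φ₂ : ℝ → ℝ) (hψ : BilinearMaximal.IsYoung ψ)
    (hφ₁ : BilinearMaximal.IsYoung φ₁) (hφ₂ : BilinearMaximal.IsYoung φ₂)
    (hψB : BilinearMaximal.IsB (p / (p - 1)) (BilinearMaximal.associate ψ))
    (hφ₁B : BilinearMaximal.IsB (p₁ / r) (BilinearMaximal.associate φ₁))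
    (hφ₂B : BilinearMaximal.IsB (p₂ / s) (BilinearMaximal.associate φ₂))
    (hbump : (⨆ (a : Fin n → ℝ) (l : ℝ) (_ : 0 < l),
      BilinearMaximal.orliczNorm ψ (BilinearMaximal.cube a l) (fun x => u x ^ (1 / p)) *
      BilinearMaximal.orliczNorm φ₁ (BilinearMaximal.cube a l)
        (fun x => v₁ x ^ (-(r / p₁))) ^ (1 / r) *
      BilinearMaximal.orliczNorm φ₂ (BilinearMaximal.cube a l)
        (fun x => v₂ x ^ (-(s / p₂))) ^ (1 / s)) < ∞) :
    ∃ C : ℝ≥0, ∀ f g : (Fin n → ℝ) → ℂ,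
      MemLp f (ENNReal.ofReal p₁) (BilinearMaximal.weighted v₁) →
      MemLp g (ENNReal.ofReal p₂) (BilinearMaximal.weighted v₂) →
      AEMeasurable (BilinearMaximal.BM f g) volume ∧
      eLpNorm (BilinearMaximal.BM f g) (ENNReal.ofReal p) (BilinearMaximal.weighted u) ≤
        C * eLpNorm f (ENNReal.ofReal p₁) (BilinearMaximal.weighted v₁) *
          eLpNorm g (ENNReal.ofReal p₂) (BilinearMaximal.weighted v₂) := by

  have hr0 : 0 < r := by linarith
  have hs0 : 0 < s := by linarith
  have hp0 : 0 < p := by linarith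
  have hp₁0 : 0 < p₁ := by linarith
  have hp₂0 : 0 < p₂ := by linarith
  obtain ⟨C, hC, hgrid⟩ := BilinearMaximal.exists_lintegral_partialSups_geomAvg_le hr hrp hs hsp hrs
    hp hp1 hu hu0 hv₁ hv₁0 hv₂ hv₂0 hψ hφ₁ hφ₂ hψB hφ₁B hφ₂B hbump
  have hfin : ((6 ^ n) ^ p * (2 ^ n * C)) ^ (1 / p) ≠ ∞ := by finiteness
  refine ⟨(((6 ^ n) ^ p * (2 ^ n * C)) ^ (1 / p)).toNNReal, fun f g hf hg => ?_⟩
  have hfm := BilinearMaximal.aemeasurable_of_memLp_weighted hv₁ hv₁0 hf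
  have hgm := BilinearMaximal.aemeasurable_of_memLp_weighted hv₂ hv₂0 hg
  have hBM := BilinearMaximal.aemeasurable_BM hfm hgm
  refine ⟨hBM, ?_⟩
  rw [BilinearMaximal.eLpNorm_weighted hp0 hu (by simpa using hBM),
    BilinearMaximal.eLpNorm_weighted hp₁0 hv₁ hfm.enorm,
    BilinearMaximal.eLpNorm_weighted hp₂0 hv₂ hgm.enorm, ENNReal.coe_toNNReal hfin]
  have key := BilinearMaximal.lintegral_BM_rpow_le hp0 hr0 hs0 hrs hfm hgm hu.ennreal_ofReal
    fun α N K => hgrid (BilinearMaximal.isNested_dyadicGrid α N) (fun k x => by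
      obtain ⟨a, ha⟩ := BilinearMaximal.cell_dyadicGrid_ae_eq α N k x
      exact ⟨a, _, by positivity, ha⟩) hfm hgm K
  simp only [enorm_eq_self]
  -- The p-th root turns the exponents p/p₁ and p/p₂ into 1/p₁ and 1/p₂.
  refine (ENNReal.rpow_le_rpow key (by positivity)).trans_eq ?_
  have h1p : 0 ≤ 1 / p := by positivity
  simp only [ENNReal.mul_rpow_of_nonneg _ _ h1p, ← ENNReal.rpow_mul]
  have e₁ : p / p₁ * (1 / p) = 1 / p₁ := by field_simp
  have e₂ : p / p₂ * (1 / p) = 1 / p₂ := by field_simp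
  rw [e₁, e₂]
  ring
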